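/- Let $M$ be a (Hausdorff, boundaryless, finite-dimensional) smooth manifold, let $E\to M$ be a smooth real vector bundle of finite rank with a Lie algebroid structure, i.e. an $\mathbb R$-bilinear alternating bracket $[\cdot,\cdot]$ on $\mathrm{Sec}(E)$ satisfying the Jacobi identity and a smooth bundle morphism (anchor) $\rho:E\to TM$ over the identity with $[X,fY]=f[X,Y]+\rho(X)(f)\,Y$ for $X,Y\in\mathrm{Sec}(E)$, $f\in C^\infty(M)$. Let $d$ be the Lie algebroid differential on forms on $E$, so that $df(X)=\rho(X)(f)$ and $d\mu(X,Y)=\rho(X)(\mu(Y))-\rho(Y)(\mu(X))-\mu([X,Y])$ for $\mu\in\mathrm{Sec}(E^*)$, and let $\mathcal L_X=i_Xd+d\,i_X$. For $\mu\in \mathrm{Sec}(E^*)$ let $\iota_\mu$ be the corresponding fibrewise linear function on $E$, and for $X\in\mathrm{Sec}(E)$ let $\iota_X$ be the corresponding fibrewise linear function on $E^*$. Let $\Lambda\in\mathcal A^2(E)=\mathrm{Sec}(\bigwedge^2E)$. Write $\sharp_\Lambda:E^*\to E$ for the bundle map $\sharp_\Lambda(\omega)=i_\omega\Lambda$, i.e.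 $\langle\sharp_\Lambda(\omega),\eta\rangle=\Lambda(\omega,\eta)$, and, for $\mu,\nu\in\mathrm{Sec}(E^*)$, put $$[\mu,\nu]_\Lambda=i_{\sharp_\Lambda(\mu)}d\nu-i_{\sharp_\Lambda(\nu)}d\mu+d(\Lambda(\mu,\nu)).$$ Let $[\![\cdot,\cdot]\!]$ be the Schouten--Nijenhuis bracket of $E$, the local biadditive bracket of multisections given on decomposable ones by $$[\![X_1\wedge\dots\wedge X_m,Y_1\wedge\dots\wedge Y_n]\!]=\sum_{k,l}(-1)^{k+l}[X_k,Y_l]\wedge X_1\wedge\dots\widehat{X_k}\dots\wedge X_m\wedge Y_1\wedge\dots\widehat{Y_l}\dots\wedge Y_n .$$ Let $\Lambda^{E^*}$ be the linear Poisson tensor on the total space of $E^*$ corresponding to the Lie algebroid: $\Lambda^{E^*}(d\iota_X,d\iota_Y)=\iota_{[X,Y]}$ for $X,Y\in\mathrm{Sec}(E)$; in the coordinates $(x^a,\xi_i)$ of $E^*$ given by a local frame $e_i$ of $E$ with $[e_i,e_j]=c_{ij}^ke_k$ it is $\frac12c_{ij}^k\xi_k\,\partial_{\xi_i}\wedge\partial_{\xi_j}+\partial_{\xi_i}\wedge\rho(e_i)$.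 Let $\Lambda^c$ be the complete Lie algebroid lift of $\Lambda$, a contravariant $2$-tensor on the total space of $E$: for $X\in\mathrm{Sec}(E)$ the lift $X^c$ is the vector field on $E$ that projects to $\rho(X)$ and satisfies $X^c(\iota_\mu)=\iota_{\mathcal L_X\mu}$ for all $\mu$, and $(X\otimes Y)^c=X^c\otimes Y^v+X^v\otimes Y^c$, where $X^v$ is the vertical lift. Then the following are equivalent: (i) $\Lambda$ is a canonical structure, i.e. $[\![\Lambda,\Lambda]\!]=0$; (ii) $\sharp_\Lambda([\mu,\nu]_\Lambda)=[\sharp_\Lambda(\mu),\sharp_\Lambda(\nu)]$ for all $\mu,\nu\in\mathrm{Sec}(E^*)$; (iii) the tensors $\Lambda^{E^*}$ on $E^*$ and $-\Lambda^c$ on $E$ are $\sharp_\Lambda$-related, i.e. $(T_\xi\sharp_\Lambda)_*\Lambda^{E^*}_\xi=-\Lambda^c_{\sharp_\Lambda(\xi)}$ for every $\xi\in E^*$. -/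

import Mathlib

open Bundle Filter
open scoped Manifold ContDiff Topology

set_option maxSynthPendingDepth 3

noncomputable section

namespace LieAlgd

/-! ### Frames and sections -/

section Setup

variable {EM : Type*} [NormedAddCommGroup EM] [NormedSpace ℝ EM]
  {H : Type*} [TopologicalSpace H] {I : ModelWithCorners ℝ EM H}
  {M : Type*} [TopologicalSpace M] [ChartedSpace H M]
  {F : Type*} [NormedAddCommGroup F] [NormedSpace ℝ F]
  {V : M → Type*} [TopologicalSpace (TotalSpace F V)] [∀ x, TopologicalSpace (V x)]
  [FiberBundle F V] [∀ x, AddCommGroup (V x)] [∀ x, Module ℝ (V x)] [VectorBundle ℝ F V]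

variable (I F V) in
/-- Smooth sections of the vector bundle `E`. -/
abbrev Sec := Cₛ^∞⟮I; F, V⟯

variable (I F V) in
/-- Smooth sections of the dual bundle `E*`. -/
abbrev DualSec := Cₛ^∞⟮I; F →L[ℝ] ℝ, fun x => V x →L[ℝ] ℝ⟯

/-- The product `f X` of a smooth function and a smooth section. -/
def smulSec (f : C^∞⟮I, M; ℝ⟯) (X : Sec I F V) : Sec I F V :=
  ⟨fun x => f x • X x, f.contMDiff.smul_section X.contMDiff⟩

theorem sum_apply {ι : Type*} (t : Finset ι) (s : ι → Sec I F V) (x : M) :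
    (∑ i ∈ t, s i) x = ∑ i ∈ t, s i x := by
  have := congrFun (map_sum (ContMDiffSection.coeAddHom I F ∞ V) s t) x
  simpa only [ContMDiffSection.coeAddHom_apply, Finset.sum_apply] using this

variable [FiniteDimensional ℝ EM] [IsManifold I ∞ M] [T2Space M]

variable (I F V) in
theorem exists_bump (x : M) : ∃ χ : SmoothBumpFunction I x,
    tsupport χ ⊆ (trivializationAt F V x).baseSet := by
  obtain ⟨χ, -, h⟩ := (SmoothBumpFunction.nhds_basis_tsupport (I := I) x).mem_iff.1
    ((trivializationAt F V x).open_baseSet.mem_nhds (mem_baseSet_trivializationAt F V x))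
  exact ⟨χ, h⟩

variable (I F V) in
/-- A smooth bump function, equal to `1` near `x`, supported where the preferred trivialization
of `E` at `x` is defined. -/
def bump (x : M) : SmoothBumpFunction I x := (exists_bump I F V x).choose

theorem tsupport_bump (x : M) : tsupport (bump I F V x) ⊆ (trivializationAt F V x).baseSet :=
  (exists_bump I F V x).choose_spec

/-- A cut-off section is smooth if it is smooth where the cut-off is supported. -/
theorem contMDiff_bump_smul (x : M) {G : Type*} [NormedAddCommGroup G] [NormedSpace ℝ G]
    {W : M → Type*} [TopologicalSpace (TotalSpace G W)] [∀ x, TopologicalSpace (W x)]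
    [FiberBundle G W] [∀ x, AddCommGroup (W x)] [∀ x, Module ℝ (W x)] [VectorBundle ℝ G W]
    (s : ∀ y, W y)
    (hs : ∀ y ∈ (trivializationAt F V x).baseSet,
      ContMDiffAt I (I.prod 𝓘(ℝ, G)) ∞ (fun y => (⟨y, s y⟩ : TotalSpace G W)) y) :
    ContMDiff I (I.prod 𝓘(ℝ, G)) ∞
      (fun y => (⟨y, bump I F V x y • s y⟩ : TotalSpace G W)) := by
  intro y
  by_cases hy : y ∈ tsupport (bump I F V x)
  · exact ContMDiffAt.smul_section (bump I F V x).contMDiffAt (hs y (tsupport_bump x hy))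
  · refine ((contMDiff_zeroSection ℝ W).contMDiffAt (x := y)).congr_of_eventuallyEq ?_
    filter_upwards [(isClosed_tsupport _).isOpen_compl.mem_nhds hy] with z hz
    have : bump I F V x z = 0 := image_eq_zero_of_notMem_tsupport hz
    simp [this, zeroSection]

variable [FiniteDimensional ℝ F] [ContMDiffVectorBundle ∞ F V I]

/-- Index set of the frames: that of a basis of the model fibre. -/
abbrev Idx (F : Type*) [NormedAddCommGroup F] [NormedSpace ℝ F] := Fin (Module.finrank ℝ F)

variable (I F V) in
/-- Smooth global sections `e_i` of `E` which, near `x`, form the frame of `E` given by the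
trivialization of `E` at `x`. -/
def frame (x : M) (i : Idx F) : Sec I F V :=
  ⟨fun y => bump I F V x y • (trivializationAt F V x).symmL ℝ y (Module.finBasis ℝ F i), by
    refine contMDiff_bump_smul x _ fun y hy => ?_
    rw [(trivializationAt F V x).contMDiffAt_section_iff hy]
    refine (contMDiffAt_const (c := Module.finBasis ℝ F i)).congr_of_eventuallyEq ?_
    filter_upwards [(trivializationAt F V x).open_baseSet.mem_nhds hy] with z hz
    rw [← Trivialization.continuousLinearMapAt_apply_of_mem (R := ℝ) _ hz,
      Trivialization.continuousLinearMapAt_symmL _ hz]⟩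

variable (I F V) in
/-- Smooth global sections `ε^i` of `E*` which, near `x`, form the frame dual to `frame I F V x`. -/
def coframe (x : M) (i : Idx F) : DualSec I F V :=
  ⟨fun y => bump I F V x y • ((LinearMap.toContinuousLinearMap ((Module.finBasis ℝ F).coord i)).comp
      ((trivializationAt F V x).continuousLinearMapAt ℝ y)), by
    refine contMDiff_bump_smul x _ fun y hy => ?_
    have hy' : y ∈ (trivializationAt (F →L[ℝ] ℝ) (fun x => V x →L[ℝ] ℝ) x).baseSet := by
      simp [hom_trivializationAt_baseSet, hy]
    rw [(trivializationAt (F →L[ℝ] ℝ) (fun x => V x →L[ℝ] ℝ) x).contMDiffAt_section_iff hy']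
    refine (contMDiffAt_const (c := LinearMap.toContinuousLinearMap
      ((Module.finBasis ℝ F).coord i))).congr_of_eventuallyEq ?_
    filter_upwards [(trivializationAt F V x).open_baseSet.mem_nhds hy] with z hz
    ext v
    simp only [hom_trivializationAt_apply, ContinuousLinearMap.inCoordinates,
      ContinuousLinearMap.comp_apply, Trivialization.continuousLinearMapAt_symmL _ hz]
    simp⟩

theorem coframe_frame (x : M) :
    ∀ᶠ y in 𝓝 x, ∀ i j, coframe I F V x i y (frame I F V x j y) = if i = j then 1 else 0 := by
  filter_upwards [(bump I F V x).eventuallyEq_one,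
    (trivializationAt F V x).open_baseSet.mem_nhds (mem_baseSet_trivializationAt F V x)]
    with y hy hz i j
  have hy' : bump I F V x y = 1 := hy
  simp only [coframe, frame, ContMDiffSection.coeFn_mk, hy', one_smul,
    ContinuousLinearMap.comp_apply, Trivialization.continuousLinearMapAt_symmL _ hz]
  simp [Finsupp.single_apply, eq_comm]

theorem sum_coframe_frame (x : M) :
    ∀ᶠ y in 𝓝 x, ∀ v : V y, ∑ i, coframe I F V x i y v • frame I F V x i y = v := by
  filter_upwards [(bump I F V x).eventuallyEq_one,
    (trivializationAt F V x).open_baseSet.mem_nhds (mem_baseSet_trivializationAt F V x)]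
    with y hy hz v
  have hy' : bump I F V x y = 1 := hy
  simp only [coframe, frame, ContMDiffSection.coeFn_mk, hy', one_smul,
    ContinuousLinearMap.comp_apply]
  have := Trivialization.symmL_continuousLinearMapAt (R := ℝ) (trivializationAt F V x) hz v
  conv_rhs => rw [← this, ← (Module.finBasis ℝ F).sum_repr
    ((trivializationAt F V x).continuousLinearMapAt ℝ y v)]
  rw [map_sum]
  refine Finset.sum_congr rfl fun i _ => ?_
  rw [map_smul]
  rfl

theorem sum_coframe_finBasis (x : M) : ∀ᶠ y in 𝓝 x, ∀ v : V y,
    (trivializationAt F V x ⟨y, v⟩).2 = ∑ i, coframe I F V x i y v • Module.finBasis ℝ F i := by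
  filter_upwards [(bump I F V x).eventuallyEq_one,
    (trivializationAt F V x).open_baseSet.mem_nhds (mem_baseSet_trivializationAt F V x)]
    with y hy hz v
  have hy' : bump I F V x y = 1 := hy
  simp only [coframe, ContMDiffSection.coeFn_mk, hy', one_smul, ContinuousLinearMap.comp_apply]
  rw [← Trivialization.continuousLinearMapAt_apply_of_mem (R := ℝ) _ hz]
  conv_lhs => rw [← (Module.finBasis ℝ F).sum_repr
    ((trivializationAt F V x).continuousLinearMapAt ℝ y v)]
  rfl

variable (I) in
/-- A smooth section of `E` through `e`, with constant components in the local frame near the base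
point of `e`. -/
def extSec (e : TotalSpace F V) : Sec I F V :=
  ∑ i, coframe I F V e.1 i e.1 e.2 • frame I F V e.1 i

variable (I) in
/-- A smooth section of `E*` through `ξ`, with constant components in the dual local frame near the
base point of `ξ`. -/
def extDual (ξ : TotalSpace (F →L[ℝ] ℝ) (fun x => V x →L[ℝ] ℝ)) : DualSec I F V :=
  ∑ i, ξ.2 (frame I F V ξ.1 i ξ.1) • coframe I F V ξ.1 i

theorem extSec_apply (e : TotalSpace F V) : extSec I e e.1 = e.2 := by
  have h := (sum_coframe_frame (I := I) (F := F) (V := V) e.1).self_of_nhds e.2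
  have h2 : extSec I e e.1 = ∑ i, coframe I F V e.1 i e.1 e.2 • frame I F V e.1 i e.1 := by
    rw [extSec, sum_apply]; rfl
  rw [h2, h]

theorem extDual_apply (ξ : TotalSpace (F →L[ℝ] ℝ) (fun x => V x →L[ℝ] ℝ)) :
    extDual I ξ ξ.1 = ξ.2 := by
  have h := (sum_coframe_frame (I := I) (F := F) (V := V) ξ.1).self_of_nhds
  have h2 : extDual I ξ ξ.1 =
      ∑ i, ξ.2 (frame I F V ξ.1 i ξ.1) • coframe I F V ξ.1 i ξ.1 := by
    rw [extDual, sum_apply]; rfl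
  rw [h2]
  ext v
  conv_rhs => rw [← h v]
  simp [mul_comm]

end Setup

/-! ### Contravariant 2-tensors on manifolds -/

section Tensors

variable {EN : Type*} [NormedAddCommGroup EN] [NormedSpace ℝ EN]
  {HN : Type*} [TopologicalSpace HN] (J : ModelWithCorners ℝ EN HN)
  {N : Type*} [TopologicalSpace N] [ChartedSpace HN N]
  {EN' : Type*} [NormedAddCommGroup EN'] [NormedSpace ℝ EN']
  {HN' : Type*} [TopologicalSpace HN'] (J' : ModelWithCorners ℝ EN' HN')
  {N' : Type*} [TopologicalSpace N'] [ChartedSpace HN' N']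

/-- A contravariant 2-tensor at `p`: a bilinear form on the cotangent space. -/
abbrev Tensor2 (p : N) :=
  (TangentSpace J p →L[ℝ] ℝ) →ₗ[ℝ] (TangentSpace J p →L[ℝ] ℝ) →ₗ[ℝ] ℝ

variable {J} in
/-- `u ⊗ v`. -/
def tmul {p : N} (u v : TangentSpace J p) : Tensor2 J p :=
  LinearMap.mk₂ ℝ (fun a b => a u * b v)
    (fun a a' b => by simp [add_mul]) (fun c a b => by simp [mul_assoc])
    (fun a b b' => by simp [mul_add]) (fun c a b => by simp [mul_left_comm])

variable {J} in
/-- `u ∧ v = u ⊗ v - v ⊗ u`. -/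
def twedge {p : N} (u v : TangentSpace J p) : Tensor2 J p := tmul u v - tmul v u

/-- The contravariant tensor fields `T` and `T'` are `φ`-related: `φ_* T_p = T'_{φ(p)}`. -/
def AreRelated (φ : N → N') (T : ∀ p : N, Tensor2 J p) (T' : ∀ q : N', Tensor2 J' q) : Prop :=
  ∀ (p : N) (a b : TangentSpace J' (φ p) →L[ℝ] ℝ),
    T p (a.comp (mfderiv J J' φ p)) (b.comp (mfderiv J J' φ p)) = T' (φ p) a b

end Tensors

/-! ### Lie algebroids -/

variable {EM : Type*} [NormedAddCommGroup EM] [NormedSpace ℝ EM]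
  {H : Type*} [TopologicalSpace H] {I : ModelWithCorners ℝ EM H}
  {M : Type*} [TopologicalSpace M] [ChartedSpace H M]
  {F : Type*} [NormedAddCommGroup F] [NormedSpace ℝ F]
  {V : M → Type*} [TopologicalSpace (TotalSpace F V)] [∀ x, TopologicalSpace (V x)]
  [FiberBundle F V] [∀ x, AddCommGroup (V x)] [∀ x, Module ℝ (V x)] [VectorBundle ℝ F V]
  [IsManifold I ∞ M]

/-- The derivative of `f` at `x` in the direction `v`. -/
def dirDeriv (f : M → ℝ) {x : M} (v : TangentSpace I x) : ℝ := mfderiv I 𝓘(ℝ, ℝ) f x v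

variable (I F V) in
/-- A Lie algebroid structure on the vector bundle `E = V` over `M`. -/
structure LieAlgebroid where
  /-- the anchor, a smooth bundle morphism `E → TM` over the identity -/
  anchor : Cₛ^∞⟮I; F →L[ℝ] EM, fun x => V x →L[ℝ] TangentSpace I x⟯
  /-- the `ℝ`-bilinear bracket of smooth sections -/
  bracket : Sec I F V →ₗ[ℝ] Sec I F V →ₗ[ℝ] Sec I F V
  bracket_self : ∀ X, bracket X X = 0
  jacobi : ∀ X Y Z,
    bracket X (bracket Y Z) = bracket (bracket X Y) Z + bracket Y (bracket X Z)
  leibniz : ∀ (X : Sec I F V) (f : C^∞⟮I, M; ℝ⟯) (Y : Sec I F V) (x : M),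
    bracket X (smulSec f Y) x =
      f x • bracket X Y x + dirDeriv f (anchor x (X x)) • Y x

variable (I F V) in
/-- A bisection `Λ ∈ A²(E)`: a smooth section of `⋀² E`, i.e. a smooth family of alternating
bilinear forms on the fibres of `E*`. -/
structure Bisection where
  /-- the bilinear form `Λ_x(α, β)` -/
  form : Cₛ^∞⟮I; (F →L[ℝ] ℝ) →L[ℝ] (F →L[ℝ] ℝ) →L[ℝ] ℝ,
    fun x => (V x →L[ℝ] ℝ) →L[ℝ] (V x →L[ℝ] ℝ) →L[ℝ] ℝ⟯
  alt : ∀ x α, form x α α = 0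

variable [FiniteDimensional ℝ EM] [T2Space M] [FiniteDimensional ℝ F] [ContMDiffVectorBundle ∞ F V I]

/-! ### The map `♯_Λ` -/

namespace Bisection

variable (P : Bisection I F V)

/-- `♯_Λ(α) = i_α Λ`, the vector with `⟨♯_Λ(α), β⟩ = Λ(α, β)`. -/
def sharpAt (x : M) (α : V x →L[ℝ] ℝ) : V x :=
  ∑ i, P.form x α (coframe I F V x i x) • frame I F V x i x

theorem apply_sharpAt (x : M) (α β : V x →L[ℝ] ℝ) : β (P.sharpAt x α) = P.form x α β := by
  have h := (sum_coframe_frame (I := I) (F := F) (V := V) x).self_of_nhds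
  have : β = ∑ i, β (frame I F V x i x) • coframe I F V x i x := by
    ext v
    conv_lhs => rw [← h v]
    simp [mul_comm]
  conv_rhs => rw [this]
  simp [sharpAt, mul_comm]

/-- `♯_Λ` as a map of total spaces `E* → E`. -/
def sharpMap (ξ : TotalSpace (F →L[ℝ] ℝ) (fun x => V x →L[ℝ] ℝ)) : TotalSpace F V :=
  ⟨ξ.1, P.sharpAt ξ.1 ξ.2⟩

theorem contMDiff_sharpMap :
    ContMDiff (I.prod 𝓘(ℝ, F →L[ℝ] ℝ)) (I.prod 𝓘(ℝ, F)) ∞ P.sharpMap := by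
  intro ξ₀
  have hπ : ContMDiff (I.prod 𝓘(ℝ, F →L[ℝ] ℝ)) I ∞
      (fun ξ : TotalSpace (F →L[ℝ] ℝ) (fun x => V x →L[ℝ] ℝ) => ξ.1) :=
    contMDiff_proj (fun x => V x →L[ℝ] ℝ)
  refine contMDiffAt_totalSpace.2 ⟨hπ.contMDiffAt, ?_⟩
  have hf : ∀ i, ContMDiffAt (I.prod 𝓘(ℝ, F →L[ℝ] ℝ)) 𝓘(ℝ, ℝ) ∞
      (fun ξ : TotalSpace (F →L[ℝ] ℝ) (fun x => V x →L[ℝ] ℝ) =>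
        P.form ξ.1 ξ.2 (coframe I F V ξ₀.1 i ξ.1)) ξ₀ := by
    intro i
    have : ContMDiffAt (I.prod 𝓘(ℝ, F →L[ℝ] ℝ)) (I.prod 𝓘(ℝ, ℝ)) ∞
        (fun ξ : TotalSpace (F →L[ℝ] ℝ) (fun x => V x →L[ℝ] ℝ) =>
          TotalSpace.mk' ℝ (E := Bundle.Trivial M ℝ) ξ.1
            (P.form ξ.1 ξ.2 (coframe I F V ξ₀.1 i ξ.1))) ξ₀ := by
      apply ContMDiffAt.clm_bundle_apply₂ (F₁ := F →L[ℝ] ℝ) (F₂ := F →L[ℝ] ℝ)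
        (E₁ := fun x => V x →L[ℝ] ℝ) (E₂ := fun x => V x →L[ℝ] ℝ)
      · exact (P.form.contMDiff.comp hπ).contMDiffAt
      · exact contMDiffAt_id
      · exact ((coframe I F V ξ₀.1 i).contMDiff.comp hπ).contMDiffAt
    simp only [contMDiffAt_totalSpace] at this
    exact this.2
  have hs : ContMDiffAt (I.prod 𝓘(ℝ, F →L[ℝ] ℝ)) 𝓘(ℝ, F) ∞
      (fun ξ : TotalSpace (F →L[ℝ] ℝ) (fun x => V x →L[ℝ] ℝ) =>
        ∑ i, P.form ξ.1 ξ.2 (coframe I F V ξ₀.1 i ξ.1) • Module.finBasis ℝ F i) ξ₀ :=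
    contMDiffAt_finsetSum fun i _ => (hf i).smul contMDiffAt_const
  refine hs.congr_of_eventuallyEq ?_
  filter_upwards [hπ.continuous.continuousAt.eventually
    (sum_coframe_finBasis (I := I) (F := F) (V := V) ξ₀.1)] with ξ hξ
  have := hξ (P.sharpAt ξ.1 ξ.2)
  simp only [apply_sharpAt] at this
  exact this

theorem contMDiff_sharp (μ : DualSec I F V) : ContMDiff I (I.prod 𝓘(ℝ, F)) ∞
    (fun x => (⟨x, P.sharpAt x (μ x)⟩ : TotalSpace F V)) :=
  P.contMDiff_sharpMap.comp μ.contMDiff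

/-- `♯_Λ` on sections. -/
def sharp (μ : DualSec I F V) : Sec I F V := ⟨fun x => P.sharpAt x (μ x), P.contMDiff_sharp μ⟩

/-- Near `x`, one has `Λ = ∑ i, e_i ⊗ ♯_Λ(ε^i)`, hence also `Λ = 1/2 ∑ i, e_i ∧ ♯_Λ(ε^i)`. -/
theorem eq_sum_frame (x : M) : ∀ᶠ y in 𝓝 x, ∀ α β : V y →L[ℝ] ℝ,
    P.form y α β =
        ∑ i, α (frame I F V x i y) * β (P.sharp (coframe I F V x i) y) ∧
    P.form y α β = (1 / 2 : ℝ) * ∑ i,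
      (α (frame I F V x i y) * β (P.sharp (coframe I F V x i) y) -
        β (frame I F V x i y) * α (P.sharp (coframe I F V x i) y)) := by
  filter_upwards [sum_coframe_frame (I := I) (F := F) (V := V) x] with y h
  have key : ∀ α β : V y →L[ℝ] ℝ, P.form y α β =
      ∑ i, α (frame I F V x i y) * β (P.sharp (coframe I F V x i) y) := by
    intro α β
    have : α = ∑ i, α (frame I F V x i y) • coframe I F V x i y := by
      ext v
      conv_lhs => rw [← h v]
      simp [mul_comm]
    conv_lhs => rw [this]
    simp [sharp, apply_sharpAt]
  have skew : ∀ α β : V y →L[ℝ] ℝ, P.form y β α = - P.form y α β := by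
    intro α β
    have := P.alt y (α + β)
    simp only [map_add, add_apply, P.alt] at this
    linarith
  intro α β
  refine ⟨key α β, ?_⟩
  rw [Finset.sum_sub_distrib, ← key, ← key, skew α β]
  ring

end Bisection

/-! ### Schouten bracket, exterior derivative, lifts -/

/-- The multivector `w_1 ∧ ⋯ ∧ w_k`, as the alternating form
`(α_1, …, α_k) ↦ det (α_i(w_j))` on the dual space. -/
def wedge {W : Type*} [AddCommGroup W] [Module ℝ W] [TopologicalSpace W] {k : ℕ} (w : Fin k → W) :
    (W →L[ℝ] ℝ) [⋀^Fin k]→ₗ[ℝ] ℝ :=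
  (Matrix.detRowAlternating (R := ℝ) (n := Fin k)).compLinearMap
    (LinearMap.pi fun j =>
      { toFun := fun α => α (w j), map_add' := fun _ _ => rfl, map_smul' := fun _ _ => rfl })

namespace LieAlgebroid

variable (A : LieAlgebroid I F V)

/-- The Schouten-Nijenhuis bracket of decomposable multisections:
`[[X_0 ∧ ⋯ ∧ X_m, Y_0 ∧ ⋯ ∧ Y_n]] =
  ∑ (-1)^(k+l) [X_k, Y_l] ∧ X_0 ∧ ⋯ X̂_k ⋯ ∧ X_m ∧ Y_0 ∧ ⋯ Ŷ_l ⋯ ∧ Y_n`. -/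
def schoutenDecomposable {m n : ℕ} (X : Fin (m + 1) → Sec I F V) (Y : Fin (n + 1) → Sec I F V)
    (x : M) : (V x →L[ℝ] ℝ) [⋀^Fin (m + n + 1)]→ₗ[ℝ] ℝ :=
  ∑ k, ∑ l, (-1 : ℝ) ^ (k.val + l.val) • wedge (Fin.cons (A.bracket (X k) (Y l) x)
    (Fin.append (fun i => X (k.succAbove i) x) (fun j => Y (l.succAbove j) x)))

/-- The Schouten-Nijenhuis bracket `[[P, Q]] ∈ A³(E)` of bisections. It is local and biadditive, so
its value at `x` comes from the decompositions `P = 1/2 ∑ i, e_i ∧ ♯_P(ε^i)` and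
`Q = 1/2 ∑ j, e_j ∧ ♯_Q(ε^j)`, valid near `x`. -/
def schouten (P Q : Bisection I F V) (x : M) : (V x →L[ℝ] ℝ) [⋀^Fin 3]→ₗ[ℝ] ℝ :=
  (1 / 4 : ℝ) • ∑ i, ∑ j, A.schoutenDecomposable (m := 1) (n := 1)
    ![frame I F V x i, P.sharp (coframe I F V x i)] ![frame I F V x j, Q.sharp (coframe I F V x j)] x

/-- `Λ` is a canonical structure: `[[Λ, Λ]] = 0`. -/
def IsCanonical (P : Bisection I F V) : Prop := ∀ x, A.schouten P P x = 0

/-- The Lie algebroid differential of a 1-form, evaluated on sections: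
`dμ(X, Y) = ρ(X)(μ(Y)) - ρ(Y)(μ(X)) - μ([X, Y])`. -/
def dForm (μ : DualSec I F V) (X Y : Sec I F V) (x : M) : ℝ :=
  dirDeriv (fun y => μ y (Y y)) (A.anchor x (X x)) -
    dirDeriv (fun y => μ y (X y)) (A.anchor x (Y x)) - μ x (A.bracket X Y x)

/-- The contraction `i_X dμ`, a 1-form, written in the local frame: `∑ i, dμ(X, e_i) ε^i`. -/
def contractD (X : Sec I F V) (μ : DualSec I F V) (x : M) : V x →L[ℝ] ℝ :=
  ∑ i, A.dForm μ X (frame I F V x i) x • coframe I F V x i x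

/-- The Lie algebroid differential of a function, `df = ρ^*(df)`. -/
def dFun (f : M → ℝ) (x : M) : V x →L[ℝ] ℝ :=
  (mfderiv I 𝓘(ℝ, ℝ) f x : TangentSpace I x →L[ℝ] ℝ).comp (A.anchor x)

/-- The bracket on sections of `E*` defined by `Λ`:
`[μ, ν]_Λ = i_{♯μ} dν - i_{♯ν} dμ + d ⟨Λ, μ ⊗ ν⟩`. -/
def coBracket (P : Bisection I F V) (μ ν : DualSec I F V) (x : M) : V x →L[ℝ] ℝ :=
  A.contractD (P.sharp μ) ν x - A.contractD (P.sharp ν) μ x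
    + A.dFun (fun y => P.form y (μ y) (ν y)) x

end LieAlgebroid

/-- The vertical vector at the point `p` of the total space of a vector bundle given by an element
`w` of the same fibre: the velocity at `t = 0` of the curve `p + t w`. -/
def vlift {G : Type*} [NormedAddCommGroup G] [NormedSpace ℝ G]
    {W : M → Type*} [TopologicalSpace (TotalSpace G W)] [∀ x, TopologicalSpace (W x)]
    [FiberBundle G W] [∀ x, AddCommGroup (W x)] [∀ x, Module ℝ (W x)]
    (p : TotalSpace G W) (w : W p.1) : TangentSpace (I.prod 𝓘(ℝ, G)) p :=
  mfderiv 𝓘(ℝ, ℝ) (I.prod 𝓘(ℝ, G)) (fun t : ℝ => (⟨p.1, p.2 + t • w⟩ : TotalSpace G W)) 0 (1 : ℝ)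

/-- The image `T_xσ(v)` of a tangent vector `v` at the base point `x` of `p` under the differential
of a section `σ` with `σ(x) = p`. -/
def slift {G : Type*} [NormedAddCommGroup G] [NormedSpace ℝ G]
    {W : M → Type*} [TopologicalSpace (TotalSpace G W)] [∀ x, TopologicalSpace (W x)]
    [FiberBundle G W]
    (p : TotalSpace G W) (σ : Cₛ^∞⟮I; G, W⟯) (v : TangentSpace I p.1) :
    TangentSpace (I.prod 𝓘(ℝ, G)) p :=
  mfderiv I (I.prod 𝓘(ℝ, G)) (fun y => (⟨y, σ y⟩ : TotalSpace G W)) p.1 v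

namespace LieAlgebroid

variable (A : LieAlgebroid I F V)

/-- The linear Poisson tensor of the Lie algebroid on the total space of `E*`. With the frame `e_i`
of `E` near the base point, `[e_i, e_j] = c_{ij}^k e_k`, and the corresponding linear coordinates
`ξ_i` on `E*`, it is `1/2 c_{ij}^k ξ_k ∂_{ξ_i} ∧ ∂_{ξ_j} + ∂_{ξ_i} ∧ ρ(e_i)`; here `∂_{ξ_i}` is the
vertical vector given by `ε^i`, and `ρ(e_i)` is lifted to `E*` with constant `ξ_k`. -/
def linearPoisson (ξ : TotalSpace (F →L[ℝ] ℝ) (fun x => V x →L[ℝ] ℝ)) :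
    Tensor2 (I.prod 𝓘(ℝ, F →L[ℝ] ℝ)) ξ :=
  (1 / 2 : ℝ) • (∑ i, ∑ j, ξ.2 (A.bracket (frame I F V ξ.1 i) (frame I F V ξ.1 j) ξ.1) •
      twedge (vlift (I := I) ξ (coframe I F V ξ.1 i ξ.1))
        (vlift (I := I) ξ (coframe I F V ξ.1 j ξ.1))) +
  ∑ i, twedge (vlift (I := I) ξ (coframe I F V ξ.1 i ξ.1))
    (slift ξ (extDual I ξ) (A.anchor ξ.1 (frame I F V ξ.1 i ξ.1)))

/-- The complete lift `X^c` of a section `X` of `E`, a vector field on the total space of `E`: for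
any section `Y` with `Y(x) = e`, `X^c(e) = T_xY(ρ(X)(x)) - ([X, Y](x))^v`. It satisfies
`X^c(ι_μ) = ι_{L_X μ}` and projects to `ρ(X)`. -/
def completeLift (X : Sec I F V) (e : TotalSpace F V) : TangentSpace (I.prod 𝓘(ℝ, F)) e :=
  slift e (extSec I e) (A.anchor e.1 (X e.1)) - vlift (I := I) e (A.bracket X (extSec I e) e.1)

/-- The complete lift `Λ^c` of a bisection, a contravariant tensor field on the total space of `E`.
As `(X ⊗ Y)^c = X^c ⊗ Y^v + X^v ⊗ Y^c`, it comes from `Λ = ∑ i, e_i ⊗ ♯_Λ(ε^i)`, valid near the base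
point. -/
def completeLift₂ (P : Bisection I F V) (e : TotalSpace F V) : Tensor2 (I.prod 𝓘(ℝ, F)) e :=
  ∑ i, (tmul (A.completeLift (frame I F V e.1 i) e)
          (vlift (I := I) e (P.sharp (coframe I F V e.1 i) e.1)) +
        tmul (vlift (I := I) e (frame I F V e.1 i e.1))
          (A.completeLift (P.sharp (coframe I F V e.1 i)) e))

end LieAlgebroid

end LieAlgd

end

set_option linter.unusedSectionVars false

noncomputable section

namespace LieAlgd

/-! ### Calculus of directional derivatives. -/

section Derivatives

variable {EM : Type*} [NormedAddCommGroup EM] [NormedSpace ℝ EM]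
  {H : Type*} [TopologicalSpace H] {I : ModelWithCorners ℝ EM H}
  {M : Type*} [TopologicalSpace M] [ChartedSpace H M] {x : M}

/-! Each of the three conditions says that one expression vanishes: the `jacobiator` J(μ, ν, λ), the
cyclic sum of λ([♯μ, ♯ν]) - ρ(♯λ)(Λ(μ, ν)). Neither summand is tensorial, but J is: it is additive
and cyclic, and if μ(x) = 0 its derivative terms cancel (`jacobiator_of_eq_zero`). So J(μ, ν, λ)(x)
depends only on the values at x (`jacobiator_congr`), and it can be computed on extensions of
covectors whose components in the local coframe are constant.

The three identifications are as follows. Pairing ♯[μ, ν]_Λ - [♯μ, ♯ν] with λ gives -J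
(`apply_coBracket`). Evaluating [[Λ, Λ]] on α, β, γ gives 2J (`schouten_apply_eq_jacobiator`). The
push-forward of the linear Poisson tensor at θ plus Λ^c, evaluated on covectors a, b with vertical
parts α, β, gives J(α, β, θ) (`linearPoisson_add_completeLift₂`): by skewness of Λ the horizontal
contributions of a and b cancel, so only the vertical parts matter.

The last two rest on expanding brackets [♯ν, Z] in a frame. This follows from tensoriality of dμ
(`dForm_eq_sum`), applied to a 1-form with constant components. -/

theorem dirDeriv_add {f g : M → ℝ} (hf : MDifferentiableAt I 𝓘(ℝ, ℝ) f x)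
    (hg : MDifferentiableAt I 𝓘(ℝ, ℝ) g x) (v : TangentSpace I x) :
    dirDeriv (fun y => f y + g y) v = dirDeriv f v + dirDeriv g v := by
  have h := congrArg (fun L => L v) (hf.hasMFDerivAt.add hg.hasMFDerivAt).mfderiv
  exact h

theorem dirDeriv_mul {f g : M → ℝ} (hf : MDifferentiableAt I 𝓘(ℝ, ℝ) f x)
    (hg : MDifferentiableAt I 𝓘(ℝ, ℝ) g x) (v : TangentSpace I x) :
    dirDeriv (fun y => f y * g y) v = f x * dirDeriv g v + g x * dirDeriv f v := by
  have h := congrArg (fun L => L v) (hf.hasMFDerivAt.mul hg.hasMFDerivAt).mfderiv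
  exact h

theorem dirDeriv_congr {f g : M → ℝ} (h : f =ᶠ[𝓝 x] g) (v : TangentSpace I x) :
    dirDeriv f v = dirDeriv g v :=
  congrArg (fun L : EM →L[ℝ] ℝ => L v) (h.mfderiv_eq (I := I) (I' := 𝓘(ℝ, ℝ)))

theorem dirDeriv_const (c : ℝ) (v : TangentSpace I x) : dirDeriv (fun _ : M => c) v = 0 :=
  congrArg (fun L => L v) (mfderiv_const (I := I) (I' := 𝓘(ℝ, ℝ)) (x := x) (c := c))

theorem dirDeriv_neg (f : M → ℝ) (v : TangentSpace I x) :
    dirDeriv (fun y => -f y) v = -dirDeriv f v :=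
  congrArg (fun L : EM →L[ℝ] ℝ => L v) (mfderiv_neg (I := I) (f := f) (x := x))

theorem dirDeriv_add_vec (f : M → ℝ) (v w : TangentSpace I x) :
    dirDeriv f (v + w) = dirDeriv f v + dirDeriv f w :=
  map_add (mfderiv I 𝓘(ℝ, ℝ) f x) v w

theorem dirDeriv_smul_vec (f : M → ℝ) (c : ℝ) (v : TangentSpace I x) :
    dirDeriv f (c • v) = c * dirDeriv f v :=
  map_smul (mfderiv I 𝓘(ℝ, ℝ) f x) c v

end Derivatives

variable {EM : Type*} [NormedAddCommGroup EM] [NormedSpace ℝ EM]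
  {H : Type*} [TopologicalSpace H] {I : ModelWithCorners ℝ EM H}
  {M : Type*} [TopologicalSpace M] [ChartedSpace H M]
  {F : Type*} [NormedAddCommGroup F] [NormedSpace ℝ F]
  {V : M → Type*} [TopologicalSpace (TotalSpace F V)] [∀ x, TopologicalSpace (V x)]
  [FiberBundle F V] [∀ x, AddCommGroup (V x)] [∀ x, Module ℝ (V x)] [VectorBundle ℝ F V]

/-! ### Pairings of sections as smooth functions, and skewness of the bracket. -/

section Pairing

variable [IsManifold I ∞ M] [ContMDiffVectorBundle ∞ F V I]

/-- The smooth function `⟨μ, X⟩`. -/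
def pairing (μ : DualSec I F V) (X : Sec I F V) : C^∞⟮I, M; ℝ⟯ :=
  ⟨fun y => μ y (X y), by
    intro x
    have : ContMDiffAt I (I.prod 𝓘(ℝ, ℝ)) ∞
        (fun y => TotalSpace.mk' ℝ (E := Bundle.Trivial M ℝ) y (μ y (X y))) x :=
      ContMDiffAt.clm_bundle_apply (F₁ := F) (E₁ := V) μ.contMDiff.contMDiffAt
        X.contMDiff.contMDiffAt
    simp only [contMDiffAt_totalSpace] at this
    exact this.2⟩

theorem mdifferentiableAt_pairing (μ : DualSec I F V) (X : Sec I F V) (x : M) :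
    MDifferentiableAt I 𝓘(ℝ, ℝ) (fun y => μ y (X y)) x :=
  (pairing μ X).contMDiff.mdifferentiable (by simp) x

theorem mdifferentiableAt_smoothMap (f : C^∞⟮I, M; ℝ⟯) (x : M) :
    MDifferentiableAt I 𝓘(ℝ, ℝ) f x :=
  f.contMDiff.mdifferentiable (by simp) x

end Pairing

variable [IsManifold I ∞ M]

namespace LieAlgebroid

theorem bracket_skew (A : LieAlgebroid I F V) (X Y : Sec I F V) :
    A.bracket X Y = -A.bracket Y X := by
  have h := A.bracket_self (X + Y)
  simp only [map_add, LinearMap.add_apply, A.bracket_self, zero_add, add_zero] at h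
  exact eq_neg_of_add_eq_zero_right h

end LieAlgebroid

variable [FiniteDimensional ℝ EM] [T2Space M] [FiniteDimensional ℝ F] [ContMDiffVectorBundle ∞ F V I]

/-! ### Tensoriality of the differential of a 1-form. -/

namespace LieAlgebroid

variable (A : LieAlgebroid I F V)

theorem dForm_add (μ : DualSec I F V) (X Y Z : Sec I F V) (x : M) :
    A.dForm μ X (Y + Z) x = A.dForm μ X Y x + A.dForm μ X Z x := by
  simp only [dForm, map_add, ContMDiffSection.coe_add, Pi.add_apply, dirDeriv_add_vec,
    dirDeriv_add (mdifferentiableAt_pairing μ Y x) (mdifferentiableAt_pairing μ Z x)]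
  ring

/-- The term ρ(X)(f) μ(Y) arises twice with opposite signs, from the product rule for f μ(Y) and
from the Leibniz rule for [X, fY]. -/
theorem dForm_smulSec (μ : DualSec I F V) (X : Sec I F V) (f : C^∞⟮I, M; ℝ⟯) (Y : Sec I F V)
    (x : M) : A.dForm μ X (smulSec f Y) x = f x * A.dForm μ X Y x := by
  have h : ∀ y, smulSec f Y y = f y • Y y := fun _ => rfl
  simp only [dForm, A.leibniz, h, map_add, map_smul, smul_eq_mul, dirDeriv_smul_vec,
    dirDeriv_mul (mdifferentiableAt_smoothMap f x) (mdifferentiableAt_pairing μ Y x)]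
  ring

theorem dForm_sum {ι : Type*} (μ : DualSec I F V) (X : Sec I F V) (t : Finset ι)
    (s : ι → Sec I F V) (x : M) :
    A.dForm μ X (∑ i ∈ t, s i) x = ∑ i ∈ t, A.dForm μ X (s i) x :=
  map_sum (AddMonoidHom.mk' (fun Z => A.dForm μ X Z x) fun Y Z => A.dForm_add μ X Y Z x) s t

/-- `dμ(X, Z)` is tensorial in `Z`. -/
theorem dForm_eq_sum (μ : DualSec I F V) (X Z : Sec I F V) (x : M) :
    A.dForm μ X Z x =
      ∑ i, coframe I F V x i x (Z x) * A.dForm μ X (frame I F V x i) x := by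
  -- The frame expands `Z` only near x. Multiplying by a bump function supported there turns the
  -- expansion into an identity of global sections, to which the algebraic rules apply.
  obtain ⟨χ, -, hχ⟩ := (SmoothBumpFunction.nhds_basis_tsupport (I := I) x).mem_iff.1
    (sum_coframe_frame (I := I) (F := F) (V := V) x)
  let f : C^∞⟮I, M; ℝ⟯ := ⟨χ, χ.contMDiff⟩
  have hf : f x = 1 := χ.eq_one
  have key : smulSec f Z =
      ∑ i, smulSec (f * pairing (coframe I F V x i) Z) (frame I F V x i) := by
    ext y
    rw [sum_apply]
    by_cases hy : y ∈ tsupport χ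
    · have h := hχ hy (Z y)
      change f y • Z y = ∑ i, (f y * coframe I F V x i y (Z y)) • frame I F V x i y
      conv_lhs => rw [← h, Finset.smul_sum]
      simp only [mul_smul]
    · have h0 : f y = 0 := image_eq_zero_of_notMem_tsupport hy
      change f y • Z y = ∑ i, (f y * coframe I F V x i y (Z y)) • frame I F V x i y
      simp [h0]
  have h1 := A.dForm_smulSec μ X f Z x
  rw [hf, one_mul] at h1
  rw [← h1, key, dForm_sum]
  refine Finset.sum_congr rfl fun i _ => ?_
  rw [dForm_smulSec]
  change f x * coframe I F V x i x (Z x) * _ = _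
  rw [hf, one_mul]

/-- If `Z` vanishes at `x`, then `μ([X, Z]) = ρ(X)(μ(Z))` at `x`. -/
theorem apply_bracket_of_eq_zero (μ : DualSec I F V) (X Z : Sec I F V) {x : M}
    (hZ : Z x = 0) :
    μ x (A.bracket X Z x) = dirDeriv (fun y => μ y (Z y)) (A.anchor x (X x)) := by
  -- By tensoriality dμ(X, Z) is zero at x, and ρ(Z)(μ(X)) vanishes there too.
  have h := A.dForm_eq_sum μ X Z x
  have h0 : ∀ f : M → ℝ, dirDeriv f (0 : TangentSpace I x) = 0 := fun f =>
    map_zero (mfderiv I 𝓘(ℝ, ℝ) f x)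
  simp only [hZ, map_zero, zero_mul, Finset.sum_const_zero, dForm, h0] at h
  linarith

theorem contractD_apply (X : Sec I F V) (μ : DualSec I F V) (Z : Sec I F V) (x : M) :
    A.contractD X μ x (Z x) = A.dForm μ X Z x := by
  rw [A.dForm_eq_sum]
  simp [contractD, mul_comm]

end LieAlgebroid

/-! ### Separation of fibre vectors by dual sections; algebra of ♯. -/

theorem eq_of_forall_dualSec {x : M} {v w : V x} (h : ∀ μ : DualSec I F V, μ x v = μ x w) :
    v = w := by
  have hs := (sum_coframe_frame (I := I) (F := F) (V := V) x).self_of_nhds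
  rw [← hs v, ← hs w]
  simp only [h]

namespace Bisection

variable (P : Bisection I F V)

theorem form_skew (x : M) (α β : V x →L[ℝ] ℝ) : P.form x β α = -P.form x α β := by
  have h := P.alt x (α + β)
  simp only [map_add, add_apply, P.alt] at h
  linarith

theorem apply_sharp (μ ν : DualSec I F V) (y : M) :
    ν y (P.sharp μ y) = P.form y (μ y) (ν y) :=
  P.apply_sharpAt y _ _

theorem sharp_add (μ ν : DualSec I F V) : P.sharp (μ + ν) = P.sharp μ + P.sharp ν := by
  ext x
  refine eq_of_forall_dualSec (I := I) (F := F) fun l => ?_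
  simp [apply_sharp]

theorem sharp_smul (c : ℝ) (μ : DualSec I F V) : P.sharp (c • μ) = c • P.sharp μ := by
  ext x
  refine eq_of_forall_dualSec (I := I) (F := F) fun l => ?_
  simp [apply_sharp]

theorem mdifferentiableAt_form (μ ν : DualSec I F V) (x : M) :
    MDifferentiableAt I 𝓘(ℝ, ℝ) (fun y => P.form y (μ y) (ν y)) x := by
  simpa only [apply_sharp] using mdifferentiableAt_pairing ν (P.sharp μ) x

end Bisection

/-! ### The jacobiator: its relation to the bracket of 1-forms, and its tensoriality. -/

namespace LieAlgebroid

variable (A : LieAlgebroid I F V) (P : Bisection I F V)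

/-- The cyclic sum of `λ([♯μ, ♯ν]) - ρ(♯λ)(Λ(μ, ν))`, the obstruction to `♯_Λ` being
a morphism of brackets. -/
def jacobiator (μ ν l : DualSec I F V) (x : M) : ℝ :=
  l x (A.bracket (P.sharp μ) (P.sharp ν) x) + μ x (A.bracket (P.sharp ν) (P.sharp l) x) +
    ν x (A.bracket (P.sharp l) (P.sharp μ) x) -
  (dirDeriv (fun y => P.form y (μ y) (ν y)) (A.anchor x (P.sharp l x)) +
    dirDeriv (fun y => P.form y (ν y) (l y)) (A.anchor x (P.sharp μ x)) +
    dirDeriv (fun y => P.form y (l y) (μ y)) (A.anchor x (P.sharp ν x)))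

theorem jacobiator_cycle (μ ν l : DualSec I F V) (x : M) :
    A.jacobiator P μ ν l x = A.jacobiator P ν l μ x := by
  simp only [jacobiator]
  ring

theorem dirDeriv_form_skew (μ ν : DualSec I F V) {x : M} (v : TangentSpace I x) :
    dirDeriv (fun y => P.form y (ν y) (μ y)) v = -dirDeriv (fun y => P.form y (μ y) (ν y)) v := by
  simp only [P.form_skew _ (μ _) (ν _), dirDeriv_neg]

theorem apply_bracket_skew (m : DualSec I F V) (X Y : Sec I F V) (x : M) :
    m x (A.bracket X Y x) = -m x (A.bracket Y X x) := by
  rw [A.bracket_skew X Y]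
  simp

/-- Skewness of Λ moves ♯ onto `l`, which produces the overall sign. The differentials of ν and μ
each contribute -ρ(♯l)(Λ(μ, ν)) and d(Λ(μ, ν)) contributes +1 copy, so a single copy is left, as in
the jacobiator. -/
theorem apply_coBracket (μ ν l : DualSec I F V) (x : M) :
    l x (P.sharpAt x (A.coBracket P μ ν x)) - l x (A.bracket (P.sharp μ) (P.sharp ν) x) =
      -A.jacobiator P μ ν l x := by
  rw [P.apply_sharpAt, P.form_skew, ← P.apply_sharpAt]
  change -(A.coBracket P μ ν x (P.sharp l x)) - _ = _
  simp only [coBracket, add_apply, sub_apply, contractD_apply]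
  have h : (A.dFun (fun y => P.form y (μ y) (ν y)) x) (P.sharp l x) =
    dirDeriv (fun y => P.form y (μ y) (ν y)) (A.anchor x (P.sharp l x)) := rfl
  rw [h]
  simp only [dForm, jacobiator, P.apply_sharp]
  rw [dirDeriv_form_skew P μ ν, dirDeriv_form_skew P ν l, A.apply_bracket_skew ν (P.sharp μ)]
  ring

theorem jacobiator_add (μ μ' ν l : DualSec I F V) (x : M) :
    A.jacobiator P (μ + μ') ν l x = A.jacobiator P μ ν l x + A.jacobiator P μ' ν l x := by
  simp only [jacobiator, P.sharp_add, map_add, LinearMap.add_apply, ContMDiffSection.coe_add,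
    Pi.add_apply, add_apply, dirDeriv_add_vec,
    dirDeriv_add (P.mdifferentiableAt_form _ _ x) (P.mdifferentiableAt_form _ _ x)]
  ring

/-- Here ♯μ also vanishes at x, so the two surviving brackets reduce to derivatives of Λ(μ, ·) along
♯ν and ♯l, and these cancel the two surviving derivative terms. With additivity this yields
dependence on point values only. -/
theorem jacobiator_of_eq_zero {μ : DualSec I F V} (ν l : DualSec I F V) {x : M} (h : μ x = 0) :
    A.jacobiator P μ ν l x = 0 := by
  have hs : P.sharp μ x = 0 := by
    refine eq_of_forall_dualSec (I := I) (F := F) fun m => ?_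
    simp [P.apply_sharp, h]
  have h0 : ∀ f : M → ℝ, dirDeriv f (0 : TangentSpace I x) = 0 := fun f =>
    map_zero (mfderiv I 𝓘(ℝ, ℝ) f x)
  simp only [jacobiator, h, hs, map_zero, h0, zero_apply, A.apply_bracket_skew l (P.sharp μ),
    A.apply_bracket_of_eq_zero _ _ (P.sharp μ) hs, P.apply_sharp, dirDeriv_form_skew P μ l]
  ring

theorem jacobiator_congr_left {μ μ' : DualSec I F V} (ν l : DualSec I F V) {x : M}
    (h : μ x = μ' x) : A.jacobiator P μ ν l x = A.jacobiator P μ' ν l x := by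
  have h1 := A.jacobiator_add P (μ - μ') μ' ν l x
  rwa [sub_add_cancel, A.jacobiator_of_eq_zero P (μ := μ - μ') ν l (by simp [h]), zero_add] at h1

theorem jacobiator_congr {μ μ' ν ν' l l' : DualSec I F V} {x : M}
    (hμ : μ x = μ' x) (hν : ν x = ν' x) (hl : l x = l' x) :
    A.jacobiator P μ ν l x = A.jacobiator P μ' ν' l' x := by
  rw [A.jacobiator_congr_left P ν l hμ, jacobiator_cycle, A.jacobiator_congr_left P l μ' hν,
    jacobiator_cycle, A.jacobiator_congr_left P μ' ν' hl, jacobiator_cycle]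

end LieAlgebroid

/-! ### Frame expansions and covectors extended with constant components. -/

variable (I F) in
theorem map_eq_sum_coframe {G : Type*} [AddCommGroup G] [Module ℝ G] {x : M}
    (φ : V x →ₗ[ℝ] G) (v : V x) :
    φ v = ∑ i, coframe I F V x i x v • φ (frame I F V x i x) := by
  conv_lhs => rw [← (sum_coframe_frame (I := I) (F := F) (V := V) x).self_of_nhds v]
  simp

variable (I F) in
/-- The extension of a covector at `x` to a section of `E*` with constant components near `x`. -/
abbrev extCovector {x : M} (α : V x →L[ℝ] ℝ) : DualSec I F V := extDual I ⟨x, α⟩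

theorem extCovector_apply {x : M} (α : V x →L[ℝ] ℝ) : extCovector I F α x = α :=
  extDual_apply (⟨x, α⟩ : TotalSpace (F →L[ℝ] ℝ) (fun x => V x →L[ℝ] ℝ))

/-- Local constancy makes every derivative of these components vanish in the frame expansions below.
-/
theorem extCovector_frame {x : M} (α : V x →L[ℝ] ℝ) (i : Idx F) :
    (fun y => extCovector I F α y (frame I F V x i y)) =ᶠ[𝓝 x]
      fun _ => α (frame I F V x i x) := by
  filter_upwards [coframe_frame (I := I) (F := F) (V := V) x] with y hy
  have h : extCovector I F α y = ∑ j, α (frame I F V x j x) • coframe I F V x j y := by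
    have := congrFun (map_sum (ContMDiffSection.coeAddHom I (F →L[ℝ] ℝ) ∞
      (fun x => V x →L[ℝ] ℝ)) (fun j => α (frame I F V x j x) • coframe I F V x j) Finset.univ) y
    simp only [ContMDiffSection.coeAddHom_apply, Finset.sum_apply] at this
    exact this
  simp [h, hy]

namespace Bisection

variable (P : Bisection I F V)

theorem sharp_extCovector {x : M} (α : V x →L[ℝ] ℝ) :
    P.sharp (extCovector I F α) =
      ∑ i, α (frame I F V x i x) • P.sharp (coframe I F V x i) := by
  have h := map_sum (AddMonoidHom.mk' P.sharp P.sharp_add)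
    (fun i => α (frame I F V x i x) • coframe I F V x i) Finset.univ
  simp only [AddMonoidHom.mk'_apply, P.sharp_smul] at h
  exact h

end Bisection

namespace LieAlgebroid

variable (A : LieAlgebroid I F V) (P : Bisection I F V)

/-- The coefficients of ♯γ in terms of the ♯ε^j are real constants, so linearity over ℝ suffices and
no derivative term appears. -/
theorem apply_bracket_sharp_extCovector {x : M} (m : DualSec I F V) (X : Sec I F V)
    (γ : V x →L[ℝ] ℝ) :
    m x (A.bracket X (P.sharp (extCovector I F γ)) x) =
      ∑ j, γ (frame I F V x j x) * m x (A.bracket X (P.sharp (coframe I F V x j)) x) := by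
  rw [P.sharp_extCovector, map_sum, sum_apply]
  simp

/-- Expansion of `[♯ν, Z]` in the frame. -/
theorem sum_form_mul_bracket_frame {x : M} (α : V x →L[ℝ] ℝ) (ν : DualSec I F V)
    (Z : Sec I F V) :
    ∑ i, P.form x (ν x) (coframe I F V x i x) * α (A.bracket (frame I F V x i) Z x) =
      α (A.bracket (P.sharp ν) Z x) +
        dirDeriv (fun y => P.form y (ν y) (extCovector I F α y)) (A.anchor x (Z x)) := by
  -- Expand dα(Z, ♯ν) in the frame. The derivatives of α(e_i) vanish, and the ρ(♯ν)(α(Z)) terms on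
  -- the two sides agree by linearity of the anchor.
  have h := A.dForm_eq_sum (extCovector I F α) Z (P.sharp ν) x
  have h1 := map_eq_sum_coframe I F
    (A.dFun (fun y => extCovector I F α y (Z y)) x : V x →ₗ[ℝ] ℝ) (P.sharp ν x)
  have h2 : ∀ (f : M → ℝ) (v : V x), dirDeriv f (A.anchor x v) = A.dFun f x v := fun _ _ => rfl
  simp only [ContinuousLinearMap.coe_coe, smul_eq_mul] at h1
  simp only [dForm, P.apply_sharp, dirDeriv_congr (extCovector_frame α _), dirDeriv_const,
    extCovector_apply] at h h1 ⊢
  rw [h2 (fun y => extCovector I F α y (Z y)) (P.sharp ν x), h1] at h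
  have h3 : ∀ X, α (A.bracket X Z x) = -α (A.bracket Z X x) := fun X => by
    rw [A.bracket_skew X Z]; simp
  simp only [h3, mul_sub, Finset.sum_sub_distrib, mul_neg, Finset.sum_neg_distrib, mul_zero,
    Finset.sum_const_zero, h2 _ (frame I F V x _ x)] at h ⊢
  linarith

/-- The bracket is expanded in both slots, and each slot costs one derivative term. The sum enters
both the Schouten bracket and the part of the linear Poisson tensor involving the structure
functions. -/
theorem sum_bracket_frame_frame {x : M} (α β γ : V x →L[ℝ] ℝ) :
    ∑ i, ∑ j, α (A.bracket (frame I F V x i) (frame I F V x j) x) *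
      (β (P.sharp (coframe I F V x i) x) * γ (P.sharp (coframe I F V x j) x)) =
    α (A.bracket (P.sharp (extCovector I F β)) (P.sharp (extCovector I F γ)) x) +
      dirDeriv (fun y => P.form y (extCovector I F β y) (extCovector I F α y))
        (A.anchor x (P.sharp (extCovector I F γ) x)) -
      dirDeriv (fun y => P.form y (extCovector I F γ y) (extCovector I F α y))
        (A.anchor x (P.sharp (extCovector I F β) x)) := by
  have hs : ∀ (δ : V x →L[ℝ] ℝ) i, δ (P.sharp (coframe I F V x i) x) =
      -P.form x δ (coframe I F V x i x) := fun δ i => by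
    rw [← P.form_skew]; exact P.apply_sharpAt x _ _
  have hb := A.sum_form_mul_bracket_frame P α (extCovector I F β)
  have hc := A.sum_form_mul_bracket_frame P α (extCovector I F γ) (P.sharp (extCovector I F β))
  have hd := map_eq_sum_coframe I F (A.dFun
    (fun y => P.form y (extCovector I F β y) (extCovector I F α y)) x : V x →ₗ[ℝ] ℝ)
    (P.sharp (extCovector I F γ) x)
  have h2 : ∀ (f : M → ℝ) (v : V x), dirDeriv f (A.anchor x v) = A.dFun f x v := fun _ _ => rfl
  have h3 : ∀ X Y, α (A.bracket X Y x) = -α (A.bracket Y X x) := fun X Y => by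
    rw [A.bracket_skew X Y]; simp
  simp only [ContinuousLinearMap.coe_coe, smul_eq_mul, P.apply_sharp, extCovector_apply]
    at hb hc hd
  rw [Finset.sum_comm]
  have step : ∀ j, ∑ i, α (A.bracket (frame I F V x i) (frame I F V x j) x) *
      (β (P.sharp (coframe I F V x i) x) * γ (P.sharp (coframe I F V x j) x)) =
      -(P.form x γ (coframe I F V x j x) *
        α (A.bracket (frame I F V x j) (P.sharp (extCovector I F β)) x)) +
      P.form x γ (coframe I F V x j x) * A.dFun
        (fun y => P.form y (extCovector I F β y) (extCovector I F α y)) x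
        (frame I F V x j x) := fun j => by
    have := hb (frame I F V x j)
    rw [h2, h3] at this
    rw [← mul_neg, ← mul_add, ← this, Finset.mul_sum]
    refine Finset.sum_congr rfl fun i _ => ?_
    rw [hs, hs]
    ring
  simp only [step]
  rw [Finset.sum_add_distrib, Finset.sum_neg_distrib, hc, ← hd, h3 (P.sharp _), h2, h2]
  ring

/-! ### The Schouten bracket [[Λ, Λ]] in terms of the jacobiator. -/

theorem schoutenDecomposable_apply (X₀ X₁ Y₀ Y₁ : Sec I F V) (x : M) (α β γ : V x →L[ℝ] ℝ) :
    A.schoutenDecomposable (m := 1) (n := 1) ![X₀, X₁] ![Y₀, Y₁] x ![α, β, γ] =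
      wedge ![A.bracket X₀ Y₀ x, X₁ x, Y₁ x] ![α, β, γ] -
      wedge ![A.bracket X₀ Y₁ x, X₁ x, Y₀ x] ![α, β, γ] -
      wedge ![A.bracket X₁ Y₀ x, X₀ x, Y₁ x] ![α, β, γ] +
      wedge ![A.bracket X₁ Y₁ x, X₀ x, Y₀ x] ![α, β, γ] := by
  have h : ∀ (a : V x) (u v : Fin 1 → V x),
      (Fin.cons a (Fin.append u v) : Fin 3 → V x) = ![a, u 0, v 0] := by
    intro a u v
    ext i
    fin_cases i <;> rfl
  have e : A.schoutenDecomposable (m := 1) (n := 1) ![X₀, X₁] ![Y₀, Y₁] x =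
      ∑ k : Fin 2, ∑ l : Fin 2, (-1 : ℝ) ^ (k.val + l.val) • wedge
        ![A.bracket (![X₀, X₁] k) (![Y₀, Y₁] l) x, ![X₀, X₁] (k.succAbove 0) x,
          ![Y₀, Y₁] (l.succAbove 0) x] :=
    Finset.sum_congr rfl fun k _ => Finset.sum_congr rfl fun l _ =>
      congrArg (fun w => (-1 : ℝ) ^ (k.val + l.val) • wedge (k := 3) w) (h _ _ _)
  rw [e]
  simp [Fin.sum_univ_two]
  ring

/-- The determinant is grouped by the covector paired with `a`, the slot that will hold the bracket.
-/
theorem wedge_three {W : Type*} [AddCommGroup W] [Module ℝ W] [TopologicalSpace W] (a b c : W)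
    (α β γ : W →L[ℝ] ℝ) :
    wedge ![a, b, c] ![α, β, γ] =
      (α a * (β b * γ c) - α a * (γ b * β c)) + (β a * (γ b * α c) - β a * (α b * γ c)) +
        (γ a * (α b * β c) - γ a * (β b * α c)) := by
  change Matrix.det (Matrix.of fun i j => (![α, β, γ] i) (![a, b, c] j)) = _
  simp [Matrix.det_fin_three]
  ring

/-- The part of `[[Λ, Λ]]` where `α` is applied to the brackets, up to a factor. -/
def schoutenTerm {x : M} (α β γ : V x →L[ℝ] ℝ) : ℝ :=
  ∑ i, ∑ j,
    let e := frame I F V x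
    let s := fun i => P.sharp (coframe I F V x i)
    (α (A.bracket (e i) (e j) x) * (β (s i x) * γ (s j x)) -
      α (A.bracket (e i) (s j) x) * (β (s i x) * γ (e j x)) -
      α (A.bracket (s i) (e j) x) * (β (e i x) * γ (s j x)) +
      α (A.bracket (s i) (s j) x) * (β (e i x) * γ (e j x)))

theorem schouten_apply {x : M} (α β γ : V x →L[ℝ] ℝ) :
    A.schouten P P x ![α, β, γ] = (1 / 4 : ℝ) *
      (A.schoutenTerm P α β γ - A.schoutenTerm P α γ β + A.schoutenTerm P β γ α -
        A.schoutenTerm P β α γ + A.schoutenTerm P γ α β - A.schoutenTerm P γ β α) := by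
  have hsum : ∀ (t : Idx F → Idx F → (V x →L[ℝ] ℝ) [⋀^Fin 3]→ₗ[ℝ] ℝ) v,
      (∑ i, ∑ j, t i j) v = ∑ i, ∑ j, t i j v := fun t v =>
    let ev : ((V x →L[ℝ] ℝ) [⋀^Fin 3]→ₗ[ℝ] ℝ) →+ ℝ := AddMonoidHom.mk' (fun f => f v) fun _ _ => rfl
    (map_sum ev _ _).trans (Finset.sum_congr rfl fun _ _ => map_sum ev _ _)
  rw [schouten, AlternatingMap.smul_apply, hsum]
  simp only [schoutenDecomposable_apply, wedge_three, schoutenTerm, smul_eq_mul,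
    ← Finset.sum_sub_distrib, ← Finset.sum_add_distrib]
  congr 1
  refine Finset.sum_congr rfl fun i _ => Finset.sum_congr rfl fun j _ => ?_
  ring

/-- Each of the four double sums contributes α([♯β, ♯γ]) once, whence the 4. A derivative correction
comes only from a slot holding a frame section e_i, not from one holding ♯ε^i, whose coefficients
are constant; each slot holds e_i in two of the four sums, whence the 2s. -/
theorem schoutenTerm_eq {x : M} (α β γ : V x →L[ℝ] ℝ) :
    A.schoutenTerm P α β γ =
      4 * α (A.bracket (P.sharp (extCovector I F β)) (P.sharp (extCovector I F γ)) x) +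
      2 * dirDeriv (fun y => P.form y (extCovector I F β y) (extCovector I F α y))
        (A.anchor x (P.sharp (extCovector I F γ) x)) -
      2 * dirDeriv (fun y => P.form y (extCovector I F γ y) (extCovector I F α y))
        (A.anchor x (P.sharp (extCovector I F β) x)) := by
  have hs : ∀ (δ : V x →L[ℝ] ℝ) i, δ (P.sharp (coframe I F V x i) x) =
      -P.form x δ (coframe I F V x i x) := fun δ i => by
    rw [← P.form_skew]; exact P.apply_sharpAt x _ _
  have h3 : ∀ X Y, α (A.bracket X Y x) = -α (A.bracket Y X x) := fun X Y => by
    rw [A.bracket_skew X Y]; simp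
  have hX : ∀ (δ : V x →L[ℝ] ℝ) X, α (A.bracket X (P.sharp (extCovector I F δ)) x) =
      ∑ j, δ (frame I F V x j x) * α (A.bracket X (P.sharp (coframe I F V x j)) x) := by
    intro δ X
    have := A.apply_bracket_sharp_extCovector P (extCovector I F α) X δ
    simpa only [extCovector_apply] using this
  have h₂ := A.sum_form_mul_bracket_frame P α (extCovector I F β) (P.sharp (extCovector I F γ))
  have h₃ := A.sum_form_mul_bracket_frame P α (extCovector I F γ) (P.sharp (extCovector I F β))
  simp only [extCovector_apply] at h₂ h₃
  simp only [schoutenTerm, Finset.sum_sub_distrib, Finset.sum_add_distrib]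
  have e₂ : ∑ i, ∑ j, α (A.bracket (frame I F V x i) (P.sharp (coframe I F V x j)) x) *
      (β (P.sharp (coframe I F V x i) x) * γ (frame I F V x j x)) =
      -∑ i, P.form x β (coframe I F V x i x) *
        α (A.bracket (frame I F V x i) (P.sharp (extCovector I F γ)) x) := by
    simp only [hX γ, Finset.mul_sum, ← Finset.sum_neg_distrib, hs]
    refine Finset.sum_congr rfl fun i _ => Finset.sum_congr rfl fun j _ => ?_
    ring
  have e₃ : ∑ i, ∑ j, α (A.bracket (P.sharp (coframe I F V x i)) (frame I F V x j) x) *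
      (β (frame I F V x i x) * γ (P.sharp (coframe I F V x j) x)) =
      ∑ j, P.form x γ (coframe I F V x j x) *
        α (A.bracket (frame I F V x j) (P.sharp (extCovector I F β)) x) := by
    rw [Finset.sum_comm]
    simp only [hX β, Finset.mul_sum, hs, h3 (P.sharp _) (frame I F V x _)]
    refine Finset.sum_congr rfl fun i _ => Finset.sum_congr rfl fun j _ => ?_
    ring
  have e₄ : ∑ i, ∑ j,
      α (A.bracket (P.sharp (coframe I F V x i)) (P.sharp (coframe I F V x j)) x) *
      (β (frame I F V x i x) * γ (frame I F V x j x)) =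
      α (A.bracket (P.sharp (extCovector I F β)) (P.sharp (extCovector I F γ)) x) := by
    rw [h3, hX β, ← Finset.sum_neg_distrib]
    refine Finset.sum_congr rfl fun i _ => ?_
    rw [h3, mul_neg, neg_neg, hX γ, Finset.mul_sum]
    refine Finset.sum_congr rfl fun j _ => ?_
    ring
  rw [A.sum_bracket_frame_frame P, e₂, e₃, e₄, h₂, h₃, h3 (P.sharp (extCovector I F γ))]
  ring

/-- Antisymmetrizing in the last two covectors doubles each `schoutenTerm`, so a bracket receives
8/4 = 2. Each derivative receives 4/4 from each of two of the three cyclic groups, again 2. -/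
theorem schouten_apply_eq_jacobiator {x : M} (α β γ : V x →L[ℝ] ℝ) :
    A.schouten P P x ![α, β, γ] =
      2 * A.jacobiator P (extCovector I F α) (extCovector I F β) (extCovector I F γ) x := by
  have h3 : ∀ (δ : V x →L[ℝ] ℝ) X Y, δ (A.bracket X Y x) = -δ (A.bracket Y X x) :=
    fun δ X Y => by rw [A.bracket_skew X Y]; simp
  rw [schouten_apply]
  simp only [schoutenTerm_eq, jacobiator, extCovector_apply]
  rw [dirDeriv_form_skew P (extCovector I F α) (extCovector I F β),
    dirDeriv_form_skew P (extCovector I F β) (extCovector I F γ),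
    dirDeriv_form_skew P (extCovector I F γ) (extCovector I F α),
    h3 α (P.sharp (extCovector I F γ)), h3 β (P.sharp (extCovector I F α)),
    h3 γ (P.sharp (extCovector I F β))]
  ring

/-! ### Conditions (i) and (ii) as vanishing of the jacobiator. -/

theorem isCanonical_iff : A.IsCanonical P ↔ ∀ (x : M) (α β γ : V x →L[ℝ] ℝ),
    A.jacobiator P (extCovector I F α) (extCovector I F β) (extCovector I F γ) x = 0 := by
  constructor
  · intro h x α β γ
    have := A.schouten_apply_eq_jacobiator P α β γ
    rw [h x] at this
    simpa using this.symm
  · intro h x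
    ext v
    have hv : v = ![v 0, v 1, v 2] := by
      funext i
      fin_cases i <;> rfl
    rw [hv, schouten_apply_eq_jacobiator, h]
    simp

theorem sharp_coBracket_iff :
    (∀ (μ ν : DualSec I F V) (x : M),
      P.sharpAt x (A.coBracket P μ ν x) = A.bracket (P.sharp μ) (P.sharp ν) x) ↔
    ∀ (x : M) (α β γ : V x →L[ℝ] ℝ),
      A.jacobiator P (extCovector I F α) (extCovector I F β) (extCovector I F γ) x = 0 := by
  constructor
  · intro h x α β γ
    have := A.apply_coBracket P (extCovector I F α) (extCovector I F β) (extCovector I F γ) x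
    rw [h, sub_self] at this
    exact neg_eq_zero.1 this.symm
  · intro h μ ν x
    refine eq_of_forall_dualSec (I := I) (F := F) fun l => sub_eq_zero.1 ?_
    rw [A.apply_coBracket P μ ν l x, A.jacobiator_congr P (extCovector_apply (μ x)).symm
      (extCovector_apply (ν x)).symm (extCovector_apply (l x)).symm, h, neg_zero]

end LieAlgebroid

/-! ### Vertical vectors, lifts along sections, and covectors on total spaces. -/

section Lifts

variable {G : Type*} [NormedAddCommGroup G] [NormedSpace ℝ G]
  {W : M → Type*} [TopologicalSpace (TotalSpace G W)] [∀ x, TopologicalSpace (W x)]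
  [FiberBundle G W] [∀ x, AddCommGroup (W x)] [∀ x, Module ℝ (W x)]

theorem contMDiff_fibre_line [VectorBundle ℝ G W] (p : TotalSpace G W) (w : W p.1) :
    ContMDiff 𝓘(ℝ, ℝ) (I.prod 𝓘(ℝ, G)) ∞
      (fun t : ℝ => (⟨p.1, p.2 + t • w⟩ : TotalSpace G W)) := by
  intro t₀
  refine contMDiffAt_totalSpace.2 ⟨contMDiffAt_const, ?_⟩
  have h : ∀ t : ℝ, (trivializationAt G W p.1 ⟨p.1, p.2 + t • w⟩).2 =
      (trivializationAt G W p.1).continuousLinearMapAt ℝ p.1 p.2 +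
        t • (trivializationAt G W p.1).continuousLinearMapAt ℝ p.1 w := fun t => by
    rw [← Trivialization.continuousLinearMapAt_apply_of_mem (R := ℝ) _
      (mem_baseSet_trivializationAt G W p.1), map_add, map_smul]
  simp only [h]
  exact contMDiffAt_const.add (contMDiffAt_id.smul contMDiffAt_const)

theorem mfderiv_vlift [VectorBundle ℝ G W] {EN HN N : Type*} [NormedAddCommGroup EN]
    [NormedSpace ℝ EN] [TopologicalSpace HN] {J : ModelWithCorners ℝ EN HN}
    [TopologicalSpace N] [ChartedSpace HN N] {f : TotalSpace G W → N} (p : TotalSpace G W)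
    (hf : MDifferentiableAt (I.prod 𝓘(ℝ, G)) J f p) (w : W p.1) :
    mfderiv (I.prod 𝓘(ℝ, G)) J f p (vlift (I := I) p w) =
      mfderiv 𝓘(ℝ, ℝ) J (fun t : ℝ => f ⟨p.1, p.2 + t • w⟩) 0 (1 : ℝ) :=
  (mfderiv_comp_apply_of_eq (I' := I.prod 𝓘(ℝ, G)) (0 : ℝ) hf
    ((contMDiff_fibre_line p w).mdifferentiable (by simp) 0) (by simp) 1).symm

theorem mfderiv_slift [VectorBundle ℝ G W] {EN HN N : Type*} [NormedAddCommGroup EN]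
    [NormedSpace ℝ EN] [TopologicalSpace HN] {J : ModelWithCorners ℝ EN HN}
    [TopologicalSpace N] [ChartedSpace HN N] {f : TotalSpace G W → N} {p : TotalSpace G W}
    (hf : MDifferentiableAt (I.prod 𝓘(ℝ, G)) J f p) {σ : Cₛ^∞⟮I; G, W⟯} (hσ : σ p.1 = p.2)
    (v : TangentSpace I p.1) :
    mfderiv (I.prod 𝓘(ℝ, G)) J f p (slift p σ v) =
      mfderiv I J (fun y => f ⟨y, σ y⟩) p.1 v :=
  (mfderiv_comp_apply_of_eq (I' := I.prod 𝓘(ℝ, G)) p.1 hf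
    (σ.contMDiff.mdifferentiable (by simp) p.1) (by rw [hσ]) v).symm

end Lifts

/-- The fibrewise linear function `ι_μ` on `E`. -/
def iota (μ : DualSec I F V) (e : TotalSpace F V) : ℝ := μ e.1 e.2

theorem contMDiff_proj_totalSpace :
    ContMDiff (I.prod 𝓘(ℝ, F)) I ∞ (fun e : TotalSpace F V => e.1) :=
  contMDiff_proj V

theorem mdifferentiableAt_proj (e : TotalSpace F V) :
    MDifferentiableAt (I.prod 𝓘(ℝ, F)) I (fun e : TotalSpace F V => e.1) e :=
  contMDiff_proj_totalSpace.mdifferentiable (by simp) e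

theorem mdifferentiableAt_iota (μ : DualSec I F V) (e : TotalSpace F V) :
    MDifferentiableAt (I.prod 𝓘(ℝ, F)) 𝓘(ℝ, ℝ) (iota μ) e := by
  have : ContMDiffAt (I.prod 𝓘(ℝ, F)) (I.prod 𝓘(ℝ, ℝ)) ∞
      (fun e : TotalSpace F V =>
        TotalSpace.mk' ℝ (E := Bundle.Trivial M ℝ) e.1 (μ e.1 e.2)) e := by
    apply ContMDiffAt.clm_bundle_apply (F₁ := F) (E₁ := V)
    · exact (μ.contMDiff.comp contMDiff_proj_totalSpace).contMDiffAt
    · exact contMDiffAt_id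
  simp only [contMDiffAt_totalSpace] at this
  exact this.2.mdifferentiableAt (by simp)

/-- The differential of `ι_μ`. -/
def dIota (μ : DualSec I F V) (e : TotalSpace F V) : TangentSpace (I.prod 𝓘(ℝ, F)) e →L[ℝ] ℝ :=
  mfderiv (I.prod 𝓘(ℝ, F)) 𝓘(ℝ, ℝ) (iota μ) e

theorem mfderiv_proj_vlift (e : TotalSpace F V) (w : V e.1) :
    mfderiv (I.prod 𝓘(ℝ, F)) I (fun e : TotalSpace F V => e.1) e (vlift (I := I) e w) = 0 := by
  rw [mfderiv_vlift e (mdifferentiableAt_proj e)]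
  exact congrArg (fun L : ℝ →L[ℝ] EM => L 1)
    (mfderiv_const (I := 𝓘(ℝ, ℝ)) (I' := I) (x := (0 : ℝ)) (c := e.1))

theorem mfderiv_proj_slift {e : TotalSpace F V} {Y : Sec I F V} (hY : Y e.1 = e.2)
    (v : TangentSpace I e.1) :
    mfderiv (I.prod 𝓘(ℝ, F)) I (fun e : TotalSpace F V => e.1) e (slift e Y v) = v := by
  rw [mfderiv_slift (mdifferentiableAt_proj e) hY]
  exact congrArg (fun L : EM →L[ℝ] EM => L v) (mfderiv_id (I := I) (x := e.1))

theorem dIota_vlift (μ : DualSec I F V) (e : TotalSpace F V) (w : V e.1) :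
    dIota μ e (vlift (I := I) e w) = μ e.1 w := by
  refine (mfderiv_vlift e (mdifferentiableAt_iota μ e) w).trans ?_
  rw [mfderiv_eq_fderiv]
  have h : (fun t : ℝ => iota μ ⟨e.1, e.2 + t • w⟩) = fun t : ℝ => μ e.1 e.2 + t * μ e.1 w := by
    funext t
    simp [iota]
  rw [h]
  have := ((hasDerivAt_id (0 : ℝ)).mul_const (μ e.1 w)).const_add (μ e.1 e.2)
  exact this.deriv.trans (one_mul _)

theorem dIota_slift (μ : DualSec I F V) {e : TotalSpace F V} {Y : Sec I F V}
    (hY : Y e.1 = e.2) (v : TangentSpace I e.1) :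
    dIota μ e (slift e Y v) =
      dirDeriv (fun y => μ y (Y y)) v :=
  mfderiv_slift (mdifferentiableAt_iota μ e) hY v

/-- The differentials of the projection and of the functions `ι_μ` separate tangent vectors of
the total space of `E`. -/
theorem tangent_ext {e : TotalSpace F V} {u u' : TangentSpace (I.prod 𝓘(ℝ, F)) e}
    (hπ : mfderiv (I.prod 𝓘(ℝ, F)) I (fun e : TotalSpace F V => e.1) e u =
      mfderiv (I.prod 𝓘(ℝ, F)) I (fun e : TotalSpace F V => e.1) e u')
    (hι : ∀ μ : DualSec I F V, dIota μ e u =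
      dIota μ e u') : u = u' := by
  set T := trivializationAt F V e.1
  have he : e ∈ T.source := FiberBundle.mem_trivializationAt_proj_source
  have hT : MDifferentiableAt (I.prod 𝓘(ℝ, F)) (I.prod 𝓘(ℝ, F)) T e :=
    ((T.contMDiffOn (n := ∞) (IB := I)).contMDiffAt (T.open_source.mem_nhds he)).mdifferentiableAt
      (by simp)
  have hT' : MDifferentiableAt (I.prod 𝓘(ℝ, F)) (I.prod 𝓘(ℝ, F))
      T.toOpenPartialHomeomorph.symm (T e) :=
    ((T.contMDiffOn_symm (n := ∞) (IB := I)).contMDiffAt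
      (T.open_target.mem_nhds (T.map_source he))).mdifferentiableAt (by simp)
  -- The trivialization has a differentiable local inverse, so its differential is injective. Its
  -- components are the differentials of the projection and of the functions given by the coframe.
  have hid : (T.toOpenPartialHomeomorph.symm ∘ T) =ᶠ[𝓝 e] id := by
    filter_upwards [T.open_source.mem_nhds he] with z hz
    exact T.toOpenPartialHomeomorph.left_inv hz
  have hinv : ∀ u : TangentSpace (I.prod 𝓘(ℝ, F)) e,
      mfderiv (I.prod 𝓘(ℝ, F)) (I.prod 𝓘(ℝ, F)) T.toOpenPartialHomeomorph.symm (T e)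
        (mfderiv (I.prod 𝓘(ℝ, F)) (I.prod 𝓘(ℝ, F)) T e u) = u := fun u => by
    rw [← mfderiv_comp_apply _ hT' hT, hid.mfderiv_eq]
    exact congrArg (fun L : EM × F →L[ℝ] EM × F => L u) (mfderiv_id (I := I.prod 𝓘(ℝ, F)) (x := e))
  have hfst : ∀ u : TangentSpace (I.prod 𝓘(ℝ, F)) e,
      (mfderiv (I.prod 𝓘(ℝ, F)) (I.prod 𝓘(ℝ, F)) T e u : EM × F).1 =
        mfderiv (I.prod 𝓘(ℝ, F)) I (fun e : TotalSpace F V => e.1) e u := fun u => by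
    have h1 : (Prod.fst ∘ T) =ᶠ[𝓝 e] fun e : TotalSpace F V => e.1 := by
      filter_upwards [T.open_source.mem_nhds he] with z hz
      exact T.coe_fst hz
    have h2 := mfderiv_comp_apply e mdifferentiableAt_fst hT u
    rw [mfderiv_fst] at h2
    have h3 := congrArg (fun L : EM × F →L[ℝ] EM => L u)
      (h1.mfderiv_eq (I := I.prod 𝓘(ℝ, F)) (I' := I))
    exact h2.symm.trans h3
  have hsnd : ∀ (u : TangentSpace (I.prod 𝓘(ℝ, F)) e) i,
      (Module.finBasis ℝ F).coord i
        (mfderiv (I.prod 𝓘(ℝ, F)) (I.prod 𝓘(ℝ, F)) T e u : EM × F).2 =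
        dIota (coframe I F V e.1 i) e u := fun u i => by
    let c : F →L[ℝ] ℝ := LinearMap.toContinuousLinearMap ((Module.finBasis ℝ F).coord i)
    have h1 : ((c ∘ Prod.snd) ∘ T) =ᶠ[𝓝 e] iota (coframe I F V e.1 i) := by
      filter_upwards [(contMDiff_proj_totalSpace (I := I)).continuous.continuousAt.eventually
        (sum_coframe_finBasis (I := I) (F := F) (V := V) e.1)] with z hz
      have := congrArg c (hz z.2)
      simpa [c, iota, Finsupp.single_apply] using this
    have hc : MDifferentiableAt 𝓘(ℝ, F) 𝓘(ℝ, ℝ) c (T e).2 := c.mdifferentiableAt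
    have h2 := mfderiv_comp_apply e (hc.comp (T e) (mdifferentiableAt_snd (I := I) (I' := 𝓘(ℝ, F))))
      hT u
    rw [mfderiv_comp (T e) hc mdifferentiableAt_snd, mfderiv_snd, c.mfderiv_eq] at h2
    have h3 := congrArg (fun L : EM × F →L[ℝ] ℝ => L u)
      (h1.mfderiv_eq (I := I.prod 𝓘(ℝ, F)) (I' := 𝓘(ℝ, ℝ)))
    exact h2.symm.trans h3
  rw [← hinv u, ← hinv u']
  congr 1
  refine Prod.ext ?_ ((Module.finBasis ℝ F).ext_elem fun i => ?_)
  · rw [hfst, hfst, hπ]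
  · have := (hsnd u i).trans ((hι _).trans (hsnd u' i).symm)
    exact this

/-- Linearity in `w` is not visible from the definition by a curve; it is detected by the separating
differentials. -/
theorem vlift_eq_sum (e : TotalSpace F V) (w : V e.1) :
    vlift (I := I) e w =
      ∑ i, coframe I F V e.1 i e.1 w • vlift (I := I) e (frame I F V e.1 i e.1) := by
  refine tangent_ext ?_ fun μ => ?_
  · simp only [map_sum, map_smul, mfderiv_proj_vlift, smul_zero, Finset.sum_const_zero]
  · simp only [map_sum, map_smul, dIota_vlift]
    exact map_eq_sum_coframe I F (μ e.1 : V e.1 →ₗ[ℝ] ℝ) w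

/-- The restriction of a covector on the total space to vertical vectors. -/
def verticalPart {e : TotalSpace F V} (a : TangentSpace (I.prod 𝓘(ℝ, F)) e →L[ℝ] ℝ) :
    V e.1 →L[ℝ] ℝ :=
  ∑ i, a (vlift (I := I) e (frame I F V e.1 i e.1)) • coframe I F V e.1 i e.1

theorem apply_vlift {e : TotalSpace F V} (a : TangentSpace (I.prod 𝓘(ℝ, F)) e →L[ℝ] ℝ)
    (w : V e.1) : a (vlift (I := I) e w) = verticalPart a w := by
  rw [vlift_eq_sum, map_sum]
  simp [verticalPart, mul_comm]

/-- Thus every covector of the fibre is the vertical part of some covector on the total space. -/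
theorem verticalPart_dIota (μ : DualSec I F V) (e : TotalSpace F V) :
    verticalPart (dIota μ e) = μ e.1 := by
  ext w
  rw [← apply_vlift]
  exact dIota_vlift μ e w

namespace Bisection

variable (P : Bisection I F V)

theorem mdifferentiableAt_sharpMap (ξ : TotalSpace (F →L[ℝ] ℝ) (fun x => V x →L[ℝ] ℝ)) :
    MDifferentiableAt (I.prod 𝓘(ℝ, F →L[ℝ] ℝ)) (I.prod 𝓘(ℝ, F)) P.sharpMap ξ :=
  P.contMDiff_sharpMap.mdifferentiable (by simp) ξ

/-- ♯ is linear on fibres, so it carries the line through ξ in direction η to the line through ♯ξ in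
direction ♯η. -/
theorem mfderiv_sharpMap_vlift (ξ : TotalSpace (F →L[ℝ] ℝ) (fun x => V x →L[ℝ] ℝ))
    (η : V ξ.1 →L[ℝ] ℝ) :
    mfderiv (I.prod 𝓘(ℝ, F →L[ℝ] ℝ)) (I.prod 𝓘(ℝ, F)) P.sharpMap ξ (vlift (I := I) ξ η) =
      vlift (I := I) (P.sharpMap ξ) (P.sharpAt ξ.1 η) := by
  rw [mfderiv_vlift ξ (P.mdifferentiableAt_sharpMap ξ)]
  have h : (fun t : ℝ => P.sharpMap ⟨ξ.1, ξ.2 + t • η⟩) = fun t : ℝ =>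
      (⟨ξ.1, P.sharpAt ξ.1 ξ.2 + t • P.sharpAt ξ.1 η⟩ : TotalSpace F V) := by
    funext t
    simp only [sharpMap]
    congr 1
    refine eq_of_forall_dualSec (I := I) (F := F) fun μ => ?_
    simp [P.apply_sharpAt]
  rw [h]
  rfl

theorem mfderiv_sharpMap_slift {ξ : TotalSpace (F →L[ℝ] ℝ) (fun x => V x →L[ℝ] ℝ)}
    {μ : DualSec I F V} (hμ : μ ξ.1 = ξ.2) (v : TangentSpace I ξ.1) :
    mfderiv (I.prod 𝓘(ℝ, F →L[ℝ] ℝ)) (I.prod 𝓘(ℝ, F)) P.sharpMap ξ (slift ξ μ v) =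
      slift (P.sharpMap ξ) (P.sharp μ) v :=
  mfderiv_slift (P.mdifferentiableAt_sharpMap ξ) hμ v

end Bisection

/-! ### Comparison of the linear Poisson tensor with the complete lift. -/

theorem tmul_apply {EN HN N : Type*} [NormedAddCommGroup EN] [NormedSpace ℝ EN]
    [TopologicalSpace HN] {J : ModelWithCorners ℝ EN HN} [TopologicalSpace N] [ChartedSpace HN N]
    {p : N} (u v : TangentSpace J p) (a b : TangentSpace J p →L[ℝ] ℝ) :
    tmul u v a b = a u * b v := rfl

theorem twedge_apply {EN HN N : Type*} [NormedAddCommGroup EN] [NormedSpace ℝ EN]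
    [TopologicalSpace HN] {J : ModelWithCorners ℝ EN HN} [TopologicalSpace N] [ChartedSpace HN N]
    {p : N} (u v : TangentSpace J p) (a b : TangentSpace J p →L[ℝ] ℝ) :
    twedge u v a b = a u * b v - a v * b u := rfl

namespace LieAlgebroid

variable (A : LieAlgebroid I F V) (P : Bisection I F V)

/-- The complete lift may be computed with any section through the given point. -/
theorem completeLift_eq (X : Sec I F V) {e : TotalSpace F V} {Y : Sec I F V} (hY : Y e.1 = e.2) :
    A.completeLift X e =
      slift e Y (A.anchor e.1 (X e.1)) - vlift (I := I) e (A.bracket X Y e.1) := by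
  have h0 : extSec I e e.1 = e.2 := extSec_apply e
  refine tangent_ext ?_ fun μ => ?_
  · simp only [completeLift, map_sub, mfderiv_proj_vlift, mfderiv_proj_slift hY,
      mfderiv_proj_slift h0]
  · simp only [completeLift, map_sub, dIota_vlift, dIota_slift μ hY,
      dIota_slift μ h0]
    -- The two sections agree at the point, so changing one into the other alters the lifted anchor
    -- term and the bracket term by the same derivative.
    have hZ : (extSec I e - Y) e.1 = 0 := by simp [h0, hY]
    have h1 := A.apply_bracket_of_eq_zero μ X _ hZ
    have h2 := dirDeriv_add (mdifferentiableAt_pairing μ (extSec I e - Y) e.1)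
      (mdifferentiableAt_pairing μ Y e.1) (A.anchor e.1 (X e.1))
    simp only [ContMDiffSection.coe_sub, Pi.sub_apply, map_sub, sub_add_cancel] at h1 h2
    linarith

theorem linearPoisson_add_completeLift₂ {x : M} (θ : V x →L[ℝ] ℝ)
    (a b : TangentSpace (I.prod 𝓘(ℝ, F)) (P.sharpMap ⟨x, θ⟩) →L[ℝ] ℝ) (α β : V x →L[ℝ] ℝ)
    (hα : verticalPart a = α) (hβ : verticalPart b = β) :
    A.linearPoisson ⟨x, θ⟩
        (a.comp (mfderiv (I.prod 𝓘(ℝ, F →L[ℝ] ℝ)) (I.prod 𝓘(ℝ, F)) P.sharpMap ⟨x, θ⟩))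
        (b.comp (mfderiv (I.prod 𝓘(ℝ, F →L[ℝ] ℝ)) (I.prod 𝓘(ℝ, F)) P.sharpMap ⟨x, θ⟩)) +
      A.completeLift₂ P (P.sharpMap ⟨x, θ⟩) a b =
    A.jacobiator P (extCovector I F α) (extCovector I F β) (extCovector I F θ) x := by
  set Y : Sec I F V := P.sharp (extCovector I F θ) with hY
  have hYe : Y x = P.sharpAt x θ := by
    change P.sharpAt x (extCovector I F θ x) = _
    rw [extCovector_apply]
  have hva : ∀ w : V x, a (vlift (I := I) (P.sharpMap ⟨x, θ⟩) w) = α w := fun w =>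
    (apply_vlift a w).trans (congrArg (fun L : V x →L[ℝ] ℝ => L w) hα)
  have hvb : ∀ w : V x, b (vlift (I := I) (P.sharpMap ⟨x, θ⟩) w) = β w := fun w =>
    (apply_vlift b w).trans (congrArg (fun L : V x →L[ℝ] ℝ => L w) hβ)
  -- Both tensors are written with the same lift of the anchor, along the section ♯θ, so that their
  -- non-vertical contributions can be compared.
  let σ : V x →ₗ[ℝ] TangentSpace (I.prod 𝓘(ℝ, F)) (P.sharpMap ⟨x, θ⟩) :=
    ((mfderiv I (I.prod 𝓘(ℝ, F)) (fun y => (⟨y, Y y⟩ : TotalSpace F V)) x).comp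
      (A.anchor x)).toLinearMap
  have hc : ∀ X : Sec I F V, A.completeLift X (P.sharpMap ⟨x, θ⟩) =
      σ (X x) - vlift (I := I) (P.sharpMap ⟨x, θ⟩) (A.bracket X Y x) := fun X =>
    A.completeLift_eq X (e := P.sharpMap ⟨x, θ⟩) hYe
  have hs : ∀ (δ : V x →L[ℝ] ℝ) i, δ (P.sharp (coframe I F V x i) x) =
      -P.form x δ (coframe I F V x i x) := fun δ i => by
    rw [← P.form_skew]; exact P.apply_sharpAt x _ _
  have h3 : ∀ (δ : V x →L[ℝ] ℝ) X Y, δ (A.bracket X Y x) = -δ (A.bracket Y X x) :=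
    fun δ X Y => by rw [A.bracket_skew X Y]; simp
  have hL : A.linearPoisson ⟨x, θ⟩
        (a.comp (mfderiv (I.prod 𝓘(ℝ, F →L[ℝ] ℝ)) (I.prod 𝓘(ℝ, F)) P.sharpMap ⟨x, θ⟩))
        (b.comp (mfderiv (I.prod 𝓘(ℝ, F →L[ℝ] ℝ)) (I.prod 𝓘(ℝ, F)) P.sharpMap ⟨x, θ⟩)) =
      (1 / 2 : ℝ) * ∑ i, ∑ j, θ (A.bracket (frame I F V x i) (frame I F V x j) x) *
        (α (P.sharp (coframe I F V x i) x) * β (P.sharp (coframe I F V x j) x) -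
          α (P.sharp (coframe I F V x j) x) * β (P.sharp (coframe I F V x i) x)) +
      ∑ i, (α (P.sharp (coframe I F V x i) x) * b (σ (frame I F V x i x)) -
        a (σ (frame I F V x i x)) * β (P.sharp (coframe I F V x i) x)) := by
    have hv : ∀ η : V x →L[ℝ] ℝ, mfderiv (I.prod 𝓘(ℝ, F →L[ℝ] ℝ)) (I.prod 𝓘(ℝ, F)) P.sharpMap
        (⟨x, θ⟩ : TotalSpace (F →L[ℝ] ℝ) (fun x => V x →L[ℝ] ℝ))
          (vlift (I := I) (⟨x, θ⟩ : TotalSpace (F →L[ℝ] ℝ) (fun x => V x →L[ℝ] ℝ)) η) =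
        vlift (I := I) (P.sharpMap ⟨x, θ⟩) (P.sharpAt x η) := P.mfderiv_sharpMap_vlift ⟨x, θ⟩
    have hh : ∀ w : V x, mfderiv (I.prod 𝓘(ℝ, F →L[ℝ] ℝ)) (I.prod 𝓘(ℝ, F)) P.sharpMap
        (⟨x, θ⟩ : TotalSpace (F →L[ℝ] ℝ) (fun x => V x →L[ℝ] ℝ))
        (slift ⟨x, θ⟩ (extDual I ⟨x, θ⟩) (A.anchor x w)) = σ w := fun w =>
      P.mfderiv_sharpMap_slift (ξ := ⟨x, θ⟩) (extDual_apply _) _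
    simp only [linearPoisson, LinearMap.add_apply, LinearMap.smul_apply, LinearMap.sum_apply,
      twedge_apply, ContinuousLinearMap.comp_apply, smul_eq_mul]
    simp only [hv, hh, hva, hvb]
    rfl
  have hR : A.completeLift₂ P (P.sharpMap ⟨x, θ⟩) a b =
      ∑ i, ((a (σ (frame I F V x i x)) - α (A.bracket (frame I F V x i) Y x)) *
          β (P.sharp (coframe I F V x i) x) +
        α (frame I F V x i x) * (b (σ (P.sharp (coframe I F V x i) x)) -
          β (A.bracket (P.sharp (coframe I F V x i)) Y x))) := by
    have h : A.completeLift₂ P (P.sharpMap ⟨x, θ⟩) = ∑ i,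
        (tmul (A.completeLift (frame I F V x i) (P.sharpMap ⟨x, θ⟩))
          (vlift (I := I) (P.sharpMap ⟨x, θ⟩) (P.sharp (coframe I F V x i) x)) +
        tmul (vlift (I := I) (P.sharpMap ⟨x, θ⟩) (frame I F V x i x))
          (A.completeLift (P.sharp (coframe I F V x i)) (P.sharpMap ⟨x, θ⟩))) := rfl
    simp only [h, LinearMap.add_apply, LinearMap.sum_apply, tmul_apply, hc, map_sub, hva, hvb]
  have e₁ := A.sum_bracket_frame_frame P θ α β
  have e₂ := A.sum_bracket_frame_frame P θ β α
  have e₃ := A.sum_form_mul_bracket_frame P α (extCovector I F β) Y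
  have e₄ : ∑ i, α (frame I F V x i x) * β (A.bracket (P.sharp (coframe I F V x i)) Y x) =
      β (A.bracket (P.sharp (extCovector I F α)) Y x) := by
    have := A.apply_bracket_sharp_extCovector P (extCovector I F β) Y α
    simp only [extCovector_apply] at this
    rw [h3, this, ← Finset.sum_neg_distrib]
    refine Finset.sum_congr rfl fun i _ => ?_
    rw [h3]
    ring
  have e₅ : ∑ i, α (frame I F V x i x) * b (σ (P.sharp (coframe I F V x i) x)) =
      b (σ (P.sharp (extCovector I F α) x)) := by
    rw [P.sharp_extCovector, sum_apply, map_sum, map_sum]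
    refine Finset.sum_congr rfl fun i _ => ?_
    have : (α (frame I F V x i x) • P.sharp (coframe I F V x i)) x =
      α (frame I F V x i x) • P.sharp (coframe I F V x i) x := rfl
    rw [this, map_smul, map_smul, smul_eq_mul]
  -- Opposite to `e₅` by skewness of Λ: the b(σ ·) terms cancel. The a(σ ·) terms cancel summand by
  -- summand.
  have e₆ : ∑ i, α (P.sharp (coframe I F V x i) x) * b (σ (frame I F V x i x)) =
      -b (σ (P.sharp (extCovector I F α) x)) := by
    rw [map_eq_sum_coframe I F σ, map_sum, ← Finset.sum_neg_distrib]
    refine Finset.sum_congr rfl fun i _ => ?_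
    rw [map_smul, smul_eq_mul, hs, P.apply_sharp, extCovector_apply, neg_mul]
  have e₇ : ∑ i, ∑ j, θ (A.bracket (frame I F V x i) (frame I F V x j) x) *
        (α (P.sharp (coframe I F V x j) x) * β (P.sharp (coframe I F V x i) x)) =
      ∑ i, ∑ j, θ (A.bracket (frame I F V x i) (frame I F V x j) x) *
        (β (P.sharp (coframe I F V x i) x) * α (P.sharp (coframe I F V x j) x)) := by
    simp only [mul_comm]
  rw [extCovector_apply] at e₃
  rw [hL, hR]
  simp only [mul_sub, sub_mul, Finset.sum_sub_distrib, Finset.sum_add_distrib]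
  rw [e₁, e₇, e₂, e₄, e₅, e₆]
  have e₈ : ∑ i, α (A.bracket (frame I F V x i) Y x) * β (P.sharp (coframe I F V x i) x) =
      -∑ i, P.form x β (coframe I F V x i x) * α (A.bracket (frame I F V x i) Y x) := by
    rw [← Finset.sum_neg_distrib]
    refine Finset.sum_congr rfl fun i _ => ?_
    rw [hs]
    ring
  rw [e₈, e₃]
  simp only [jacobiator, extCovector_apply, ← hY]
  rw [dirDeriv_form_skew P (extCovector I F α) (extCovector I F β),
    dirDeriv_form_skew P (extCovector I F θ) (extCovector I F α),
    h3 θ (P.sharp (extCovector I F β)), h3 β Y]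
  ring

/-- Only vertical parts enter the comparison, so testing on differentials of fibrewise linear
functions already reaches all α, β, while the point of E* supplies γ. -/
theorem areRelated_iff :
    AreRelated (I.prod 𝓘(ℝ, F →L[ℝ] ℝ)) (I.prod 𝓘(ℝ, F)) P.sharpMap A.linearPoisson
      (-A.completeLift₂ P) ↔
    ∀ (x : M) (α β γ : V x →L[ℝ] ℝ),
      A.jacobiator P (extCovector I F α) (extCovector I F β) (extCovector I F γ) x = 0 := by
  constructor
  · intro h x α β γ
    have h1 := A.linearPoisson_add_completeLift₂ P γ
      (dIota (extCovector I F α) (P.sharpMap ⟨x, γ⟩))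
      (dIota (extCovector I F β) (P.sharpMap ⟨x, γ⟩)) α β
      ((verticalPart_dIota _ _).trans (extCovector_apply α))
      ((verticalPart_dIota _ _).trans (extCovector_apply β))
    rw [h ⟨x, γ⟩] at h1
    rw [← h1]
    exact neg_add_cancel _
  · rintro h ⟨x, θ⟩ a b
    exact eq_neg_of_add_eq_zero_left
      ((A.linearPoisson_add_completeLift₂ P θ a b _ _ rfl rfl).trans (h x _ _ θ))

end LieAlgebroid

end LieAlgd

end

theorem mainTheorem2
    {EM : Type*} [NormedAddCommGroup EM] [NormedSpace ℝ EM] [FiniteDimensional ℝ EM]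
    {H : Type*} [TopologicalSpace H] {I : ModelWithCorners ℝ EM H}
    {M : Type*} [TopologicalSpace M] [ChartedSpace H M] [IsManifold I ∞ M]
    [BoundarylessManifold I M] [T2Space M]
    {F : Type*} [NormedAddCommGroup F] [NormedSpace ℝ F] [FiniteDimensional ℝ F]
    {V : M → Type*} [TopologicalSpace (TotalSpace F V)] [∀ x, TopologicalSpace (V x)]
    [FiberBundle F V] [∀ x, AddCommGroup (V x)] [∀ x, Module ℝ (V x)] [VectorBundle ℝ F V]
    [ContMDiffVectorBundle ∞ F V I]
    (A : LieAlgd.LieAlgebroid I F V) (Λ : LieAlgd.Bisection I F V) :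
    List.TFAE
      [A.IsCanonical Λ,
       ∀ (μ ν : LieAlgd.DualSec I F V) (x : M),
         Λ.sharpAt x (A.coBracket Λ μ ν x) = A.bracket (Λ.sharp μ) (Λ.sharp ν) x,
       LieAlgd.AreRelated (I.prod 𝓘(ℝ, F →L[ℝ] ℝ)) (I.prod 𝓘(ℝ, F)) Λ.sharpMap
         A.linearPoisson (-A.completeLift₂ Λ)] := by
  tfae_have 1 ↔ 2 := (A.isCanonical_iff Λ).trans (A.sharp_coBracket_iff Λ).symm
  tfae_have 1 ↔ 3 := (A.isCanonical_iff Λ).trans (A.areRelated_iff Λ).symm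
  tfae_finish
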